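/- **Setting.** Let $N:\mathbb{R}\to(0,\infty)$ and $\alpha:\mathbb{R}\to\mathbb{R}$ be smooth, and for $n\in\mathbb{Z}$ put $R_n(x)=[n-\alpha(x)]N(x)$. Let $\mathcal{H}=L^2([0,2\pi]\times\mathbb{R},d\omega\,dx)$, and let $U(\lambda)=\exp(i\lambda\hat\phi)$, $\lambda\in\mathbb{R}$, be the unitary group generated by the self-adjoint operator $\hat\phi=-iN(x)\partial_\omega$ with boundary condition $\psi(0,x)=e^{2\pi i\alpha(x)}\psi(2\pi,x)$; explicitly, $U(\lambda)$ translates $\omega$ by $\lambda N(x)$ modulo $2\pi$, with a factor $e^{-2\pi i\alpha(x)}$ for each passage through $\omega=2\pi$. Writing $\psi(\omega,x)=(2\pi)^{-1/2}\sum_{n\in\mathbb{Z}}e^{i[n-\alpha(x)]\omega}\psi_n(x)$, one has $(U(\lambda)\psi)_n=e^{iR_n\lambda}\psi_n$. Let $\Phi\subset\mathcal{H}$ be the dense subspace of those $\psi$ for which only finitely many $\psi_n$ are nonzero and each is smooth with compact support, and let $\Phi^*$ be its algebraic dual. The set $\mathcal{A}_{\mathrm{obs}}$ of observables consists of the (possibly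 unbounded, densely defined) operators $A$ on $\mathcal{H}$ such that the domains of $A$ and $A^\dagger$ include $\Phi$, both $A$ and $A^\dagger$ map $\Phi$ to itself, and $A$ commutes with every $U(\lambda)$ on $\Phi$; $A$ acts on $\Phi^*$ by $(AF)[g]=F[A^\dagger g]$. A *rigging map* is an antilinear map $\eta:\Phi\to\Phi^*$ such that for all $f,g\in\Phi$: $\eta(f)[g]=\overline{\eta(g)[f]}$; $\eta(f)[f]\ge0$; $\eta(f)$ is invariant under the dual action of every $U(\lambda)$; and $\eta(Af)[g]=\eta(f)[A^\dagger g]$ for all $A\in\mathcal{A}_{\mathrm{obs}}$. **Assumptions.** (a) For each $n$ the stationary point set of $R_n$ is either empty or the union of at most countably many isolated points, at most countably many closed intervals and at most two closed half-lines, such that any compact subset of $\mathbb{R}$ contains at most finitely many of the isolated points and at most finitely many of the finite intervals. (b$'$) The set $\{x:\alpha(x)\in\mathbb{Z}\}$ is non-empty, at most countable and without accumulation points, and at each of its points $\alpha$ has a nonvanishing derivative of some order $\ge1$. The *order* of a zero $x$ of $R_n$ (that is, of a solution of $\alpha(x)=n$) is the least $p\ge1$ with $\alpha^{(p)}(x)\ne0$.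 Let $\mathcal{P}$ be the set of orders of the zeros of all the $R_n$, $n\in\mathbb{Z}$. (c) If $p\in\mathcal{P}$, then $\mathcal{P}$ contains no factor of $p$ smaller than $p/2$. **Theorem.** For each odd $p\in\mathcal{P}$ let $$\eta_p(f)[g]=\sum_{(n,x)}\frac{\overline{f_n(x)}\,g_n(x)}{|\alpha^{(p)}(x)N(x)|^{1/p}},$$ where the sum is over all pairs $(n,x)$ such that $x$ is a zero of $R_n$ of order $p$. For each even $p\in\mathcal{P}$ and each $\epsilon\in\{1,-1\}$ such that $\alpha^{(p)}$ has the sign $\epsilon$ at some zero of order $p$, let $\eta_{p\epsilon}(f)[g]$ be the same sum restricted to the zeros of order $p$ at which $\alpha^{(p)}$ has the sign $\epsilon$. For all $f,g\in\Phi$ these sums have only finitely many nonzero terms, and: 1. Each $\eta_p$ and each $\eta_{p\epsilon}$ is a rigging map $\Phi\to\Phi^*$ with nontrivial (nonzero) image. 2. The representation of $\mathcal{A}_{\mathrm{obs}}$ on the image of each $\eta_p$ and $\eta_{p\epsilon}$ is irreducible: the image is mapped to itself by $\mathcal{A}_{\mathrm{obs}}$, and the only linear subspaces of the image that are mapped to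 themselves by $\mathcal{A}_{\mathrm{obs}}$ are $\{0\}$ and the image itself. -/

import Mathlib

open MeasureTheory
open scoped ContDiff LinearPMap

noncomputable section

namespace RAQ

/-- The remaining data of the constrained system: the smooth positive function `N` encoding the
classical rescaling of the constraint, and the smooth function `α` encoding the self-adjoint
extension of the quantum constraint (`2πα(x)` is the phase shift between `ω = 2π` and `ω = 0`). -/
structure ScalingData where
  α : ℝ → ℝ
  N : ℝ → ℝ
  α_smooth : ContDiff ℝ ∞ α
  N_smooth : ContDiff ℝ ∞ N
  N_pos : ∀ x, 0 < N x

/-! ### The auxiliary Hilbert space `L²([0,2π] × ℝ, dω dx)` -/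

/-- Lebesgue measure `dω dx` on `[0,2π] × ℝ`. -/
def auxMeasure : Measure (ℝ × ℝ) :=
  (volume.restrict (Set.Icc (0 : ℝ) (2 * Real.pi))).prod volume

/-- The auxiliary Hilbert space; a point of the base is `(ω, x)`. -/
abbrev Haux : Type := Lp ℂ 2 auxMeasure

/-- Smooth complex functions of compact support on `ℝ`. -/
def testFunctions : Submodule ℂ (ℝ → ℂ) where
  carrier := {ψ | ContDiff ℝ ∞ ψ ∧ HasCompactSupport ψ}
  add_mem' := fun h₁ h₂ => ⟨h₁.1.add h₂.1, h₁.2.add h₂.2⟩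
  zero_mem' := ⟨contDiff_const, HasCompactSupport.zero⟩
  smul_mem' := fun c _ h => ⟨contDiff_const.smul h.1, h.2.smul_left (f := fun _ => c)⟩

variable (S : ScalingData)

/-- `R_n(x) = (n - α(x)) N(x)`. -/
def ScalingData.R (n : ℤ) (x : ℝ) : ℝ := ((n : ℝ) - S.α x) * S.N x

/-- The function `(ω, x) ↦ (2π)^{-1/2} e^{i (n - α(x)) ω} ψ(x)`. -/
def modeFun (n : ℤ) (ψ : ℝ → ℂ) (z : ℝ × ℝ) : ℂ :=
  ((Real.sqrt (2 * Real.pi) : ℝ) : ℂ)⁻¹ *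
    Complex.exp (Complex.I * ((((n : ℝ) - S.α z.2) * z.1 : ℝ) : ℂ)) * ψ z.2

theorem modeFun_continuous (n : ℤ) {ψ : ℝ → ℂ} (hψ : Continuous ψ) :
    Continuous (modeFun S n ψ) := by
  have := S.α_smooth.continuous
  unfold modeFun
  fun_prop

theorem modeFun_memLp (n : ℤ) (ψ : testFunctions) :
    MemLp (modeFun S n ψ.1) 2 auxMeasure := by
  have hc : Continuous ψ.1 := ψ.2.1.continuous
  have h1 : MemLp (fun z : ℝ × ℝ => (1 : ℂ) * ψ.1 z.2) 2 auxMeasure := by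
    have hψ : MemLp ψ.1 2 (volume : Measure ℝ) := hc.memLp_of_hasCompactSupport ψ.2.2
    simpa [Function.comp_def, auxMeasure] using
      hψ.comp_snd (volume.restrict (Set.Icc (0 : ℝ) (2 * Real.pi)))
  refine (h1.const_mul ((Real.sqrt (2 * Real.pi) : ℝ) : ℂ)⁻¹).of_le
    (modeFun_continuous S n hc).aestronglyMeasurable (ae_of_all _ fun z => ?_)
  simp [modeFun, Complex.norm_exp]

/-- The `n`-th mode `(2π)^{-1/2} e^{i (n - α(x)) ω} ψ(x)` as an element of `Haux`. -/
def mode (n : ℤ) : testFunctions →ₗ[ℂ] Haux where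
  toFun ψ := (modeFun_memLp S n ψ).toLp _
  map_add' ψ χ := by
    rw [← MemLp.toLp_add]
    congr 1
    funext z
    simp [modeFun, mul_add]
  map_smul' c ψ := by
    rw [RingHom.id_apply, ← MemLp.toLp_const_smul]
    congr 1
    funext z
    simp [modeFun, mul_left_comm]

/-- Finitely many components `ψ_n ∈ C_c^∞(ℝ)` are sent to the state
`(2π)^{-1/2} ∑ₙ e^{i (n - α(x)) ω} ψ_n(x)`. -/
def synth : (ℤ →₀ testFunctions) →ₗ[ℂ] Haux :=
  Finsupp.lsum ℂ (mode S)

theorem integral_exp_int (k : ℤ) :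
    ∫ u in Set.Icc (0 : ℝ) (2 * Real.pi), Complex.exp (Complex.I * ((k : ℂ) * (u : ℂ)))
      = if k = 0 then (2 * Real.pi : ℂ) else 0 := by
  rw [integral_Icc_eq_integral_Ioc,
    ← intervalIntegral.integral_of_le (by positivity : (0 : ℝ) ≤ 2 * Real.pi)]
  split_ifs with h
  · subst h
    simp
  · have hk : Complex.I * (k : ℂ) ≠ 0 := by simp [h]
    simp_rw [← mul_assoc]
    rw [integral_exp_mul_complex hk]
    have : Complex.exp (Complex.I * (k : ℂ) * ((2 * Real.pi : ℝ) : ℂ)) = 1 := by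
      rw [← Complex.exp_int_mul_two_pi_mul_I k]
      congr 1
      push_cast
      ring
    rw [this]
    simp

theorem inner_mode (m n : ℤ) (ψ χ : testFunctions) :
    inner ℂ (mode S m ψ) (mode S n χ)
      = if m = n then ∫ x, (starRingEnd ℂ) (ψ.1 x) * χ.1 x else 0 := by
  have hpi : (Real.sqrt (2 * Real.pi) : ℂ) * (Real.sqrt (2 * Real.pi) : ℂ) = 2 * Real.pi := by
    rw [← Complex.ofReal_mul, Real.mul_self_sqrt (by positivity)]
    push_cast
    ring
  have hpi0 : (2 * Real.pi : ℂ) ≠ 0 := by simp [Real.pi_ne_zero]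
  rw [L2.inner_def]
  have h1 : (fun z => inner ℂ ((mode S m ψ : Haux) z) ((mode S n χ : Haux) z))
      =ᵐ[auxMeasure] fun z : ℝ × ℝ =>
        ((2 * Real.pi : ℂ)⁻¹ * Complex.exp (Complex.I * (((n - m : ℤ) : ℂ) * (z.1 : ℂ)))) *
          ((starRingEnd ℂ) (ψ.1 z.2) * χ.1 z.2) := by
    filter_upwards [(modeFun_memLp S m ψ).coeFn_toLp, (modeFun_memLp S n χ).coeFn_toLp]
      with z hz1 hz2
    simp only [mode, LinearMap.coe_mk, AddHom.coe_mk]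
    rw [hz1, hz2, RCLike.inner_apply]
    simp only [modeFun, map_mul, map_inv₀, Complex.conj_ofReal, ← Complex.exp_conj,
      Complex.conj_I]
    have he : Complex.exp (Complex.I * (((n - m : ℤ) : ℂ) * (z.1 : ℂ)))
        = Complex.exp (Complex.I * ((((n : ℝ) - S.α z.2) * z.1 : ℝ) : ℂ)) *
          Complex.exp (-Complex.I * ((((m : ℝ) - S.α z.2) * z.1 : ℝ) : ℂ)) := by
      rw [← Complex.exp_add]
      congr 1
      push_cast
      ring
    rw [he, ← hpi, mul_inv]
    ring
  rw [integral_congr_ae h1, auxMeasure,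
    integral_prod_mul
      (fun u : ℝ => (2 * Real.pi : ℂ)⁻¹ *
        Complex.exp (Complex.I * (((n - m : ℤ) : ℂ) * (u : ℂ))))
      (fun x => (starRingEnd ℂ) (ψ.1 x) * χ.1 x),
    integral_const_mul, integral_exp_int]
  by_cases h : m = n
  · rw [if_pos (sub_eq_zero.mpr h.symm), if_pos h, inv_mul_cancel₀ hpi0, one_mul]
  · have : n - m ≠ 0 := sub_ne_zero.mpr (Ne.symm h)
    simp [h, this]

theorem inner_mode_synth (m : ℤ) (ψ : testFunctions) (f : ℤ →₀ testFunctions) :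
    inner ℂ (mode S m ψ) (synth S f) = ∫ x, (starRingEnd ℂ) (ψ.1 x) * (f m).1 x := by
  rw [synth, Finsupp.lsum_apply, Finsupp.sum, inner_sum]
  simp_rw [inner_mode]
  rw [Finset.sum_ite_eq]
  split_ifs with h
  · rfl
  · simp [Finsupp.notMem_support_iff.mp h]

/-- The components of a state are unique. -/
theorem synth_injective : Function.Injective (synth S) := by
  rw [injective_iff_map_eq_zero]
  intro f hf
  ext m x
  have h := inner_mode_synth S m (f m) f
  rw [hf, inner_zero_right] at h
  have hc : Continuous (f m).1 := (f m).2.1.continuous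
  have h2 : ∫ x, ‖(f m).1 x‖ ^ 2 = 0 := by
    have : ∫ x, ((‖(f m).1 x‖ ^ 2 : ℝ) : ℂ) = 0 := by
      rw [h]
      refine integral_congr_ae (ae_of_all _ fun x => ?_)
      simp [Complex.conj_mul']
    have h4 := integral_ofReal (μ := volume) (𝕜 := ℂ) (f := fun x => ‖(f m).1 x‖ ^ 2)
    exact Complex.ofReal_eq_zero.mp (h4.symm.trans this)
  have hcs : HasCompactSupport fun x => ‖(f m).1 x‖ ^ 2 :=
    (f m).2.2.comp_left (g := fun w : ℂ => ‖w‖ ^ 2) (by simp)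
  have hint : Integrable fun x => ‖(f m).1 x‖ ^ 2 :=
    (by fun_prop : Continuous fun x => ‖(f m).1 x‖ ^ 2).integrable_of_hasCompactSupport hcs
  rw [integral_eq_zero_iff_of_nonneg (fun x => by positivity) hint] at h2
  have h3 := (Continuous.ae_eq_iff_eq volume (by fun_prop) continuous_const).mp h2
  have h5 : ‖(f m).1 x‖ ^ 2 = 0 := congrFun h3 x
  simpa using h5

/-- The test space `Φ`: states with finitely many nonzero components, each of them smooth with
compact support. -/
def testSpace : Submodule ℂ Haux := LinearMap.range (synth S)

/-- All components of a test state: `f ↦ (f_n)_n`. -/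
def components : testSpace S ≃ₗ[ℂ] (ℤ →₀ testFunctions) :=
  (LinearEquiv.ofInjective (synth S) (synth_injective S)).symm

/-- The component `f_n : ℝ → ℂ` of `f ∈ Φ`. -/
def comp (f : testSpace S) (n : ℤ) : ℝ → ℂ := (components S f n).1

/-! ### The gauge group `U(t) = exp(i t φ)`, `φ = -i N(x) ∂_ω`

With the boundary condition `ψ(0,x) = e^{2πiα(x)} ψ(2π,x)`, `U(t)` translates `ω` by `t N(x)` modulo
`2π`, with a factor `e^{-2πiα(x)}` for each passage through `ω = 2π`. -/

/-- The number of passages of `ω + t N(x)` through `2π`. -/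
def winding (t : ℝ) (z : ℝ × ℝ) : ℤ := ⌊(z.1 + t * S.N z.2) / (2 * Real.pi)⌋

/-- The translation `(ω, x) ↦ (ω + t N(x) mod 2π, x)`. -/
def flow (t : ℝ) (z : ℝ × ℝ) : ℝ × ℝ :=
  (z.1 + t * S.N z.2 - 2 * Real.pi * (winding S t z : ℝ), z.2)

/-- The phase acquired from the boundary condition. -/
def phase (t : ℝ) (z : ℝ × ℝ) : ℂ :=
  Complex.exp (-(Complex.I * ((2 * Real.pi * S.α z.2 * (winding S t z : ℝ) : ℝ) : ℂ)))

theorem winding_measurable (t : ℝ) : Measurable (winding S t) := by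
  have := S.N_smooth.continuous.measurable
  unfold winding
  fun_prop

theorem flow_measurable (t : ℝ) : Measurable (flow S t) := by
  have := S.N_smooth.continuous.measurable
  have h : Measurable fun z => (winding S t z : ℝ) :=
    (measurable_from_top (f := fun n : ℤ => (n : ℝ))).comp (winding_measurable S t)
  unfold flow
  fun_prop

theorem phase_measurable (t : ℝ) : Measurable (phase S t) := by
  have := S.α_smooth.continuous.measurable
  have h : Measurable fun z => (winding S t z : ℝ) :=
    (measurable_from_top (f := fun n : ℤ => (n : ℝ))).comp (winding_measurable S t)
  unfold phase
  fun_prop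

theorem norm_phase (t : ℝ) (z : ℝ × ℝ) : ‖phase S t z‖ = 1 := by
  simp [phase, Complex.norm_exp]

/-- Rotation of the circle `ℝ / 2πℤ`, read on `[0, 2π]`, preserves Lebesgue measure. -/
theorem rotation_map (c : ℝ) :
    Measure.map (fun u : ℝ => u + c - 2 * Real.pi * (⌊(u + c) / (2 * Real.pi)⌋ : ℝ))
      (volume.restrict (Set.Icc (0 : ℝ) (2 * Real.pi)))
      = volume.restrict (Set.Icc (0 : ℝ) (2 * Real.pi)) := by
  have hp : (0 : ℝ) < 2 * Real.pi := by positivity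
  have : Fact ((0 : ℝ) < 2 * Real.pi) := ⟨hp⟩
  have hmk := AddCircle.measurePreserving_mk (2 * Real.pi) 0
  rw [zero_add, restrict_Ioc_eq_restrict_Icc] at hmk
  let e : AddCircle (2 * Real.pi) → ℝ := fun z => (AddCircle.measurableEquivIco (2 * Real.pi) 0 z).1
  have he : Measurable e := measurable_subtype_coe.comp (MeasurableEquiv.measurable _)
  have hemk : ∀ w : ℝ, e (w : AddCircle (2 * Real.pi))
      = w - 2 * Real.pi * (⌊w / (2 * Real.pi)⌋ : ℝ) := by
    intro w
    have h1 : e (w : AddCircle (2 * Real.pi)) = toIcoMod hp 0 w := rfl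
    rw [h1, toIcoMod_eq_fract_mul, Int.fract]
    field_simp
  have h1 : Measure.map e volume = volume.restrict (Set.Icc (0 : ℝ) (2 * Real.pi)) := by
    rw [← hmk.map_eq, Measure.map_map he hmk.measurable]
    conv_rhs => rw [← Measure.map_id (μ := volume.restrict (Set.Icc (0 : ℝ) (2 * Real.pi)))]
    refine Measure.map_congr ?_
    rw [← restrict_Ico_eq_restrict_Icc]
    filter_upwards [ae_restrict_mem measurableSet_Ico] with w hw
    have : ⌊w / (2 * Real.pi)⌋ = 0 := by
      rw [Int.floor_eq_zero_iff]
      exact ⟨div_nonneg hw.1 hp.le, (div_lt_one hp).mpr hw.2⟩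
    simp [hemk, this]
  have h2 : (fun u : ℝ => u + c - 2 * Real.pi * (⌊(u + c) / (2 * Real.pi)⌋ : ℝ))
      = e ∘ (fun z => z + (c : AddCircle (2 * Real.pi))) ∘
        (fun w : ℝ => (w : AddCircle (2 * Real.pi))) := by
    funext u
    simp only [Function.comp_apply]
    rw [← AddCircle.coe_add, hemk]
  have hrot := measurePreserving_add_right
    (volume : Measure (AddCircle (2 * Real.pi))) (c : AddCircle (2 * Real.pi))
  rw [h2, ← Measure.map_map he (hrot.measurable.comp hmk.measurable),
    (hrot.comp hmk).map_eq, h1]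

theorem flow_measurePreserving (t : ℝ) :
    MeasurePreserving (flow S t) auxMeasure auxMeasure := by
  have hN := S.N_smooth.continuous.measurable
  have hm : Measurable (Function.uncurry fun x u : ℝ => (flow S t (u, x)).1) :=
    (measurable_fst.comp (flow_measurable S t)).comp measurable_swap
  have h := (MeasurePreserving.id (volume : Measure ℝ)).skew_product
    (μc := volume.restrict (Set.Icc (0 : ℝ) (2 * Real.pi)))
    (μd := volume.restrict (Set.Icc (0 : ℝ) (2 * Real.pi))) hm
    (ae_of_all _ fun x => rotation_map (t * S.N x))
  exact (Measure.measurePreserving_swap.comp h).comp Measure.measurePreserving_swap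

theorem gauge_memLp (t : ℝ) (ψ : Haux) :
    MemLp (fun z => phase S t z * ψ (flow S t z)) 2 auxMeasure := by
  have h := (Lp.memLp ψ).comp_measurePreserving (flow_measurePreserving S t)
  refine h.of_le ((phase_measurable S t).aestronglyMeasurable.mul h.1) (ae_of_all _ fun z => ?_)
  simp [norm_phase]

/-- The gauge transformation `U(t)`, as an isometry of the auxiliary Hilbert space:
`(U(t)ψ)(ω, x) = phase · ψ(ω + t N(x) mod 2π, x)`. -/
def gauge (t : ℝ) : Haux →ₗᵢ[ℂ] Haux where
  toFun ψ := (gauge_memLp S t ψ).toLp _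
  map_add' ψ χ := by
    rw [← MemLp.toLp_add]
    refine (MemLp.toLp_eq_toLp_iff _ _).mpr ?_
    have h := (flow_measurePreserving S t).quasiMeasurePreserving.ae (Lp.coeFn_add ψ χ)
    filter_upwards [h] with z hz
    rw [hz]
    simp [mul_add]
  map_smul' c ψ := by
    rw [RingHom.id_apply, ← MemLp.toLp_const_smul]
    refine (MemLp.toLp_eq_toLp_iff _ _).mpr ?_
    have h := (flow_measurePreserving S t).quasiMeasurePreserving.ae (Lp.coeFn_smul c ψ)
    filter_upwards [h] with z hz
    rw [hz]
    simp [mul_left_comm]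
  norm_map' ψ := by
    simp only [LinearMap.coe_mk, AddHom.coe_mk]
    rw [Lp.norm_toLp, Lp.norm_def]
    congr 1
    rw [← eLpNorm_comp_measurePreserving (Lp.aestronglyMeasurable ψ) (flow_measurePreserving S t)]
    exact eLpNorm_congr_norm_ae (ae_of_all _ fun z => by simp [norm_phase])

/-- Multiplication of a test function by `e^{i R_n(x) t}`. -/
def phaseMul (t : ℝ) (n : ℤ) (ψ : testFunctions) : testFunctions :=
  ⟨fun x => Complex.exp (Complex.I * ((S.R n x * t : ℝ) : ℂ)) * ψ.1 x, by
    have h1 := S.α_smooth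
    have h2 := S.N_smooth
    have h3 : ContDiff ℝ ∞ fun x => S.R n x * t := by
      unfold ScalingData.R
      fun_prop
    exact ⟨(contDiff_const.mul (Complex.ofRealCLM.contDiff.comp h3)).cexp.mul ψ.2.1,
      ψ.2.2.mul_left⟩⟩

/-- `(U(t)ψ)_n = e^{i R_n t} ψ_n` on a single mode. -/
theorem gauge_mode (t : ℝ) (n : ℤ) (ψ : testFunctions) :
    gauge S t (mode S n ψ) = mode S n (phaseMul S t n ψ) := by
  change (gauge_memLp S t (mode S n ψ)).toLp _ = (modeFun_memLp S n (phaseMul S t n ψ)).toLp _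
  refine (MemLp.toLp_eq_toLp_iff _ _).mpr ?_
  have h := (flow_measurePreserving S t).quasiMeasurePreserving.ae
    (modeFun_memLp S n ψ).coeFn_toLp
  filter_upwards [h] with z hz
  simp only [mode, LinearMap.coe_mk, AddHom.coe_mk]
  rw [hz]
  simp only [modeFun, phase, flow, phaseMul, ScalingData.R]
  generalize winding S t z = k
  have hexp : Complex.exp (-(Complex.I * ((2 * Real.pi * S.α z.2 * (k : ℝ) : ℝ) : ℂ))) *
      Complex.exp (Complex.I * ((((n : ℝ) - S.α z.2) *
        (z.1 + t * S.N z.2 - 2 * Real.pi * (k : ℝ)) : ℝ) : ℂ))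
      = Complex.exp (Complex.I * ((((n : ℝ) - S.α z.2) * z.1 : ℝ) : ℂ)) *
        Complex.exp (Complex.I * ((((n : ℝ) - S.α z.2) * S.N z.2 * t : ℝ) : ℂ)) := by
    rw [← Complex.exp_add, ← Complex.exp_add, Complex.exp_eq_exp_iff_exists_int]
    refine ⟨-(n * k), ?_⟩
    push_cast
    ring
  calc _ = ((Real.sqrt (2 * Real.pi) : ℝ) : ℂ)⁻¹ *
        (Complex.exp (-(Complex.I * ((2 * Real.pi * S.α z.2 * (k : ℝ) : ℝ) : ℂ))) *
        Complex.exp (Complex.I * ((((n : ℝ) - S.α z.2) *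
        (z.1 + t * S.N z.2 - 2 * Real.pi * (k : ℝ)) : ℝ) : ℂ))) * ψ.1 z.2 := by ring
    _ = _ := by
      rw [hexp]
      ring

/-- `Φ` is invariant under the gauge group. -/
theorem gauge_mem (t : ℝ) {ψ : Haux} (hψ : ψ ∈ testSpace S) : gauge S t ψ ∈ testSpace S := by
  obtain ⟨f, rfl⟩ := hψ
  rw [synth, Finsupp.lsum_apply, Finsupp.sum, map_sum]
  refine Submodule.sum_mem _ fun n _ => ?_
  rw [gauge_mode]
  exact ⟨Finsupp.single n (phaseMul S t n (f n)), by simp [synth]⟩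

/-- The restriction of `U(t)` to `Φ`. -/
def gaugeTest (t : ℝ) : testSpace S →ₗ[ℂ] testSpace S :=
  (gauge S t).toLinearMap.restrict fun _ h => gauge_mem S t h

/-! ### Observables and rigging maps -/

/-- An observable: a densely defined, possibly unbounded operator `A` on the auxiliary Hilbert space
such that the domains of `A` and of its adjoint include `Φ`, both map `Φ` to itself, and `A`
commutes with the gauge group on `Φ`. -/
structure Observable where
  op : Haux →ₗ.[ℂ] Haux
  dense : Dense (op.domain : Set Haux)
  le_domain : testSpace S ≤ op.domain
  le_adjoint_domain : testSpace S ≤ op†.domain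
  maps : ∀ f : testSpace S, op ⟨f, le_domain f.2⟩ ∈ testSpace S
  adjoint_maps : ∀ f : testSpace S, op† ⟨f, le_adjoint_domain f.2⟩ ∈ testSpace S
  commutes : ∀ (t : ℝ) (f : testSpace S),
    op ⟨gaugeTest S t f, le_domain (gaugeTest S t f).2⟩ = gauge S t (op ⟨f, le_domain f.2⟩)

variable {S}

/-- `A` restricted to `Φ`. -/
def Observable.act (A : Observable S) : testSpace S →ₗ[ℂ] testSpace S :=
  (A.op.toFun ∘ₗ Submodule.inclusion A.le_domain).codRestrict _ A.maps

/-- `A†` restricted to `Φ`. -/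
def Observable.adjAct (A : Observable S) : testSpace S →ₗ[ℂ] testSpace S :=
  (A.op†.toFun ∘ₗ Submodule.inclusion A.le_adjoint_domain).codRestrict _ A.adjoint_maps

/-- The action of an observable on the algebraic dual `Φ*`: `(A F)[g] = F[A† g]`. -/
def Observable.dualAct (A : Observable S) :
    Module.Dual ℂ (testSpace S) →ₗ[ℂ] Module.Dual ℂ (testSpace S) :=
  A.adjAct.dualMap

variable (S)

/-- Antilinear maps `Φ → Φ*`. -/
abbrev AntilinearToDual : Type :=
  testSpace S →ₛₗ[starRingEnd ℂ] Module.Dual ℂ (testSpace S)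

variable {S}

/-- The axioms of a rigging map. -/
structure IsRiggingMap (η : AntilinearToDual S) : Prop where
  real : ∀ f g, η f g = starRingEnd ℂ (η g f)
  nonneg : ∀ f, ∃ r : ℝ, 0 ≤ r ∧ η f f = (r : ℂ)
  /-- The dual action of `U(t)` on `F ∈ Φ*` is `g ↦ F[U(-t) g]`. -/
  invariant : ∀ (t : ℝ) (f : testSpace S), (gaugeTest S (-t)).dualMap (η f) = η f
  intertwines : ∀ (A : Observable S) (f g : testSpace S), η (A.act f) g = η f (A.adjAct g)

/-- The observables act irreducibly on the image of `η`: the image is nonzero, it is stable under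
the observables, and its only stable linear subspaces are `0` and itself. -/
structure ActsIrreducibly (η : AntilinearToDual S) : Prop where
  nonzero : LinearMap.range η ≠ ⊥
  stable : ∀ A : Observable S, ∀ F ∈ LinearMap.range η, A.dualAct F ∈ LinearMap.range η
  irreducible : ∀ W : Submodule ℂ (Module.Dual ℂ (testSpace S)), W ≤ LinearMap.range η →
    (∀ A : Observable S, ∀ F ∈ W, A.dualAct F ∈ W) → W = ⊥ ∨ W = LinearMap.range η

/-! ### Conditions on `α` and `N` -/

/-- Shape of a stationary point set: a union of at most countably many isolated points `P`, at most
countably many closed intervals (end points in `J`) and at most two closed half-lines (`H`), only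
finitely many of the points and of the intervals lying in any compact set. All three may be empty. -/
def IsTameSet (T : Set ℝ) : Prop :=
  ∃ (P : Set ℝ) (J : Set (ℝ × ℝ)) (H : Set (Set ℝ)),
    T = P ∪ (⋃ I ∈ J, Set.Icc I.1 I.2) ∪ ⋃₀ H ∧
    P.Countable ∧ (∀ x ∈ P, ∃ V ∈ nhds x, T ∩ V = {x}) ∧
    J.Countable ∧ (∀ I ∈ J, I.1 < I.2) ∧
    H.encard ≤ 2 ∧ (∀ h ∈ H, ∃ a, h = Set.Iic a ∨ h = Set.Ici a) ∧
    ∀ K : Set ℝ, IsCompact K → (P ∩ K).Finite ∧ {I ∈ J | Set.Icc I.1 I.2 ⊆ K}.Finite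

variable (S)

/-- Condition (a), on the stationary points of every `R_n`. -/
def ConditionA : Prop := ∀ n : ℤ, IsTameSet {x | deriv (S.R n) x = 0}

/-- The integer value set of `α`. -/
def integerSet : Set ℝ := {x | ∃ n : ℤ, S.α x = n}

/-- Condition (b′), on the integer values of `α`. -/
def ConditionB' : Prop :=
  (integerSet S).Nonempty ∧ (integerSet S).Countable ∧
  (∀ x : ℝ, ¬ AccPt x (Filter.principal (integerSet S))) ∧
  ∀ x ∈ integerSet S, ∃ k : ℕ, 1 ≤ k ∧ iteratedDeriv k S.α x ≠ 0

/-- The lowest nonvanishing derivative of `α` at `x`, of order at least one, has order `p`. -/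
def HasOrder (p : ℕ) (x : ℝ) : Prop :=
  1 ≤ p ∧ (∀ k, 1 ≤ k → k < p → iteratedDeriv k S.α x = 0) ∧ iteratedDeriv p S.α x ≠ 0

/-- The zeroes `x` of `R_n` of order `p`, for all `n`, as pairs `(n, x)`. -/
def zeros (p : ℕ) : Set (ℤ × ℝ) := {z | S.R z.1 z.2 = 0 ∧ HasOrder S p z.2}

/-- Those zeroes in `zeros S p` at which the `p`-th derivative of `α` has the sign `ε`. -/
def signedZeros (p : ℕ) (ε : SignType) : Set (ℤ × ℝ) :=
  {z ∈ zeros S p | SignType.sign (iteratedDeriv p S.α z.2) = ε}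

/-- The set of all orders of zeroes. -/
def orders : Set ℕ := {p | (zeros S p).Nonempty}

/-- Condition (c): if `p ∈ 𝒫`, then `𝒫` contains no factor of `p` smaller than `p / 2`. -/
def ConditionC : Prop :=
  ∀ p ∈ orders S, ∀ q ∈ orders S, q ∣ p → ¬ ((q : ℝ) < (p : ℝ) / 2)

variable {S}

/-- `η` is given by the sum of `conj (f_n(x)) g_n(x) / |α⁽ᵖ⁾(x) N(x)|^{1/p}` over `(n, x) ∈ Z`;
for all `f` and `g` only finitely many terms are nonzero. -/
def IsZeroSum (p : ℕ) (Z : Set (ℤ × ℝ)) (η : AntilinearToDual S) : Prop :=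
  ∀ f g : testSpace S,
    (Function.support fun z : Z =>
      starRingEnd ℂ (comp S f z.1.1 z.1.2) * comp S g z.1.1 z.1.2).Finite ∧
    η f g = ∑ᶠ z : Z,
      starRingEnd ℂ (comp S f z.1.1 z.1.2) * comp S g z.1.1 z.1.2 /
        ((|iteratedDeriv p S.α z.1.2 * S.N z.1.2| ^ (1 / (p : ℝ)) : ℝ) : ℂ)

end RAQ

end

/-
If `A` is an observable and `f, g ∈ Φ`, then `⟨U(-t) A f, g⟩ = ⟨U(-t) f, A† g⟩` for all `t`, which
says that the sum over `n` of the images under `R_n` of the measures `h_n(x) dx`, with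
`h_n = conj (A f)_n g_n - conj f_n (A† g)_n`, has vanishing Fourier transform. Hence
`∑ ∫_{0 < τ R_n < s} h_n = 0` for every `s > 0` and each sign `τ`. As `s → 0⁺` this sum has an
expansion in fractional powers of `s`: in a coordinate `y` with `R_n = ± y ^ q` near a zero of order
`q`, the contribution of that zero is a smooth function of `s ^ (1/q)`. The power `s ^ (1/p)` comes
only from zeros of orders `q` divisible by `p`. Those of order `q = 2p` do not contribute, because
the terms of second order from the two sides of the zero cancel, and (c) excludes larger multiples
of `p`. What is left of the coefficient of `s ^ (1/p)` is a multiple of `η(A f)[g] - η(f)[A† g]`,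
the sum being over those zeros of order `p` next to which `τ R_n` takes positive values: for odd `p`
all of them, on one side each, and for even `p` and `τ = -ε` those at which `α⁽ᵖ⁾` has the sign `ε`,
on both sides.

Irreducibility holds because the germs of the `R_n` at any two zeros in the sum are related by a
local diffeomorphism. Transport along it, cut off near the zero, is an observable which acts on the
evaluations at the zeros as a matrix unit.
-/

open scoped Manifold Topology

noncomputable section

namespace RAQ

/-! ### Smooth functions on the line near a zero -/

section Factorization

variable {E : Type*} [NormedAddCommGroup E] [NormedSpace ℝ E]

/-- The average of `φ` over the segment from `a` to `x` with weight `w`, as a function of `x`. It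
is the form taken by the remainder in Taylor's formula. -/
def segmentAverage (a : ℝ) (w : ℝ → ℝ) (φ : ℝ → E) (x : ℝ) : E :=
  ∫ t in (0 : ℝ)..1, w t • φ (a + t * (x - a))

theorem hasDerivAt_segmentAverage (a : ℝ) {w : ℝ → ℝ} {φ : ℝ → E} (hw : Continuous w)
    (hφ : ContDiff ℝ 1 φ) (x : ℝ) :
    HasDerivAt (segmentAverage a w φ) (segmentAverage a (fun t => w t * t) (deriv φ) x) x := by
  have hφc : Continuous φ := hφ.continuous
  have : Continuous (deriv φ) := hφ.continuous_deriv_one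
  obtain ⟨C, hC⟩ := (isCompact_Icc (a := (0 : ℝ)) (b := 1)).prod
    (isCompact_closedBall x 1) |>.exists_bound_of_continuousOn
    (f := fun z : ℝ × ℝ => (w z.1 * z.1) • deriv φ (a + z.1 * (z.2 - a))) (by fun_prop)
  have hderiv : ∀ t y : ℝ, HasDerivAt (fun y => w t • φ (a + t * (y - a)))
      ((w t * t) • deriv φ (a + t * (y - a))) y := by
    intro t y
    have hline : HasDerivAt (fun y : ℝ => a + t * (y - a)) t y := by
      simpa using (((hasDerivAt_id y).sub_const a).const_mul t).const_add a
    have hcomp := ((hφ.differentiable one_ne_zero) (a + t * (y - a))).hasDerivAt.scomp y hline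
    exact (hcomp.const_smul (w t)).congr_deriv (smul_smul _ _ _)
  refine (intervalIntegral.hasDerivAt_integral_of_dominated_loc_of_deriv_le (bound := fun _ => C)
    (Metric.closedBall_mem_nhds x one_pos)
    (.of_forall fun y => Continuous.aestronglyMeasurable (by fun_prop))
    (Continuous.intervalIntegrable (by fun_prop) _ _)
    (Continuous.aestronglyMeasurable (by fun_prop)) (.of_forall fun t ht y hy => hC (t, y) ⟨?_, hy⟩)
    intervalIntegrable_const (.of_forall fun t _ y _ => hderiv t y)).2
  rw [Set.uIoc_of_le zero_le_one] at ht
  exact Set.Ioc_subset_Icc_self ht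

theorem contDiff_segmentAverage (a : ℝ) {w : ℝ → ℝ} {φ : ℝ → E} (hw : Continuous w)
    (hφ : ContDiff ℝ ∞ φ) : ContDiff ℝ ∞ (segmentAverage a w φ) := by
  rw [contDiff_infty]
  intro n
  induction n generalizing w φ with
  | zero =>
    exact contDiff_zero.mpr (continuous_iff_continuousAt.mpr fun x =>
      (hasDerivAt_segmentAverage a hw (hφ.of_le (by simp)) x).continuousAt)
  | succ n ih =>
    have hderiv := hasDerivAt_segmentAverage a hw (hφ.of_le (by simp))
    rw [Nat.cast_add, Nat.cast_one, contDiff_succ_iff_deriv, funext fun x => (hderiv x).deriv]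
    exact ⟨fun x => (hderiv x).differentiableAt, by simp,
      ih (hw.mul continuous_id) (contDiff_infty_iff_deriv.mp hφ).2⟩

/-- A generalization of **Hadamard's lemma** to zeros of higher order. -/
theorem exists_eq_pow_smul [CompleteSpace E] {f : ℝ → E} (hf : ContDiff ℝ ∞ f) {a : ℝ} {p : ℕ}
    (h0 : ∀ k < p, iteratedDeriv k f a = 0) :
    ∃ G : ℝ → E, ContDiff ℝ ∞ G ∧ (∀ x, f x = (x - a) ^ p • G x) ∧
      G a = (p.factorial : ℝ)⁻¹ • iteratedDeriv p f a := by
  cases p with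
  | zero => exact ⟨f, hf, by simp, by simp⟩
  | succ n =>
    have hderiv : ContDiff ℝ ∞ (iteratedDeriv (n + 1) f) := by
      rw [iteratedDeriv_eq_iterate]
      exact hf.iterate_deriv (n + 1)
    refine ⟨(n.factorial : ℝ)⁻¹ •
      segmentAverage a (fun t => (1 - t) ^ n) (iteratedDeriv (n + 1) f),
      contDiff_const.smul (contDiff_segmentAverage a (by fun_prop) hderiv), fun x => ?_, ?_⟩
    · have htaylor := map_add_eq_sum_add_integral_iteratedFDeriv (n := n) (f := f) (x := a)
        (y := x - a) fun t _ => (hf.of_le (by exact_mod_cast le_top)).contDiffAt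
      simp only [iteratedFDeriv_apply_eq_iteratedDeriv_mul_prod, Finset.prod_const,
        Finset.card_univ, Fintype.card_fin, add_sub_cancel, smul_eq_mul] at htaylor
      rw [htaylor, Finset.sum_eq_zero, zero_add]
      · simp_rw [smul_comm _ ((x - a) ^ (n + 1))]
        rw [intervalIntegral.integral_smul, smul_comm, Pi.smul_apply, segmentAverage]
      · intro k hk
        rw [h0 k (Finset.mem_range.mp hk), smul_zero, smul_zero]
    · have hint : ∫ t in (0 : ℝ)..1, (1 - t) ^ n = ((n : ℝ) + 1)⁻¹ := by
        simp [intervalIntegral.integral_comp_sub_left (fun t : ℝ => t ^ n)]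
      rw [Pi.smul_apply, segmentAverage]
      simp only [sub_self, mul_zero, add_zero]
      rw [intervalIntegral.integral_smul_const, hint, smul_smul, Nat.factorial_succ]
      push_cast
      rw [mul_inv_rev]

end Factorization

section Diffeo

variable {e : OpenPartialHomeomorph ℝ ℝ} {x y : ℝ}

theorem mem_contDiffGroupoid_iff :
    e ∈ contDiffGroupoid ∞ 𝓘(ℝ, ℝ) ↔
      ContDiffOn ℝ ∞ e e.source ∧ ContDiffOn ℝ ∞ e.symm e.target := by
  simp [contDiffGroupoid, mem_groupoid_of_pregroupoid, contDiffPregroupoid]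

theorem neg_mem_contDiffGroupoid :
    (Homeomorph.neg ℝ).toOpenPartialHomeomorph ∈ contDiffGroupoid ∞ 𝓘(ℝ, ℝ) :=
  mem_contDiffGroupoid_iff.mpr ⟨contDiff_neg.contDiffOn, contDiff_neg.contDiffOn⟩

theorem contDiffAt_of_mem_contDiffGroupoid (he : e ∈ contDiffGroupoid ∞ 𝓘(ℝ, ℝ))
    (hx : x ∈ e.source) : ContDiffAt ℝ ∞ e x :=
  (mem_contDiffGroupoid_iff.mp he).1.contDiffAt (e.open_source.mem_nhds hx)

theorem hasDerivAt_of_mem_contDiffGroupoid (he : e ∈ contDiffGroupoid ∞ 𝓘(ℝ, ℝ))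
    (hx : x ∈ e.source) : HasDerivAt e (deriv e x) x :=
  ((contDiffAt_of_mem_contDiffGroupoid he hx).differentiableAt (by simp)).hasDerivAt

theorem deriv_symm_mul_deriv (he : e ∈ contDiffGroupoid ∞ 𝓘(ℝ, ℝ)) (hx : x ∈ e.source) :
    deriv e.symm (e x) * deriv e x = 1 := by
  have hcomp := (hasDerivAt_of_mem_contDiffGroupoid (StructureGroupoid.symm _ he)
    (e.map_source hx)).comp x (hasDerivAt_of_mem_contDiffGroupoid he hx)
  refine hcomp.unique ((hasDerivAt_id x).congr_of_eventuallyEq ?_)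
  filter_upwards [e.open_source.mem_nhds hx] with y hy using e.left_inv hy

theorem deriv_symm_ne_zero (he : e ∈ contDiffGroupoid ∞ 𝓘(ℝ, ℝ)) (hy : y ∈ e.target) :
    deriv e.symm y ≠ 0 := by
  have h := deriv_symm_mul_deriv he (e.map_target hy)
  rw [e.right_inv hy] at h
  exact left_ne_zero_of_mul_eq_one h

theorem exists_mem_contDiffGroupoid_coe_eq {φ : ℝ → ℝ} {a : ℝ} {V : Set ℝ} (hV : V ∈ 𝓝 a)
    (hφ : ContDiffOn ℝ ∞ φ V) (hd : deriv φ a ≠ 0) :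
    ∃ e ∈ contDiffGroupoid ∞ 𝓘(ℝ, ℝ), a ∈ e.source ∧ e.source ⊆ V ∧ (e : ℝ → ℝ) = φ := by
  have hφa : ContDiffAt ℝ ∞ φ a := hφ.contDiffAt hV
  have hdcont : ContinuousAt (deriv φ) a :=
    ((hφa.of_le (by simp : (1 : WithTop ℕ∞) ≤ ∞)).derivWithin (m := 0) (by simp)).continuousAt
  obtain ⟨s, hs, hso, has⟩ := mem_nhds_iff.mp
    (Filter.inter_mem hV (hdcont.eventually_ne hd))
  have hequiv := (hφa.differentiableAt (by simp)).hasDerivAt.hasFDerivAt_equiv hd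
  let e := (hφa.toOpenPartialHomeomorph φ hequiv (by simp)).restrOpen s hso
  have hsrc : e.source ⊆ s := Set.inter_subset_right
  have hsmooth : ∀ x ∈ e.source, ContDiffAt ℝ ∞ e x := fun x hx =>
    hφ.contDiffAt (Filter.mem_of_superset (hso.mem_nhds (hsrc hx)) fun y hy => (hs hy).1)
  refine ⟨e, mem_contDiffGroupoid_iff.mpr ⟨fun x hx => (hsmooth x hx).contDiffWithinAt,
    fun u hu => ?_⟩, ⟨hφa.mem_toOpenPartialHomeomorph_source hequiv (by simp), has⟩,
    fun x hx => (hs (hsrc hx)).1, rfl⟩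
  have hx := hsmooth _ (e.map_target hu)
  exact (e.contDiffAt_symm_deriv (hs (hsrc (e.map_target hu))).2 hu
    (hx.differentiableAt (by simp)).hasDerivAt hx).contDiffWithinAt

/-- The `p`-th root of `|G|` absorbs `|G|` into the coordinate. -/
theorem exists_normalForm {f G : ℝ → ℝ} (hG : ContDiff ℝ ∞ G) {a : ℝ} {p : ℕ} (hp : p ≠ 0)
    (hf : ∀ x, f x = (x - a) ^ p * G x) (hGa : G a ≠ 0) :
    ∃ e ∈ contDiffGroupoid ∞ 𝓘(ℝ, ℝ), a ∈ e.source ∧ e a = 0 ∧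
      deriv e a = |G a| ^ (1 / (p : ℝ)) ∧
      ∀ x ∈ e.source, f x = SignType.sign (G a) * e x ^ p := by
  let φ : ℝ → ℝ := fun x => (x - a) * |G x| ^ (1 / (p : ℝ))
  have hroot : ∀ x, G x ≠ 0 → ContDiffAt ℝ ∞ (fun x => |G x| ^ (1 / (p : ℝ))) x := fun x hx =>
    ((contDiffAt_abs hx).comp x hG.contDiffAt).rpow_const_of_ne (abs_ne_zero.mpr hx)
  have hφa : HasDerivAt φ (|G a| ^ (1 / (p : ℝ))) a :=
    (((hasDerivAt_id a).sub_const a).mul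
      ((hroot a hGa).differentiableAt (by simp)).hasDerivAt).congr_deriv (by simp)
  have hGne : ∀ᶠ x in 𝓝 a, G x ≠ 0 := hG.continuous.continuousAt.eventually_ne hGa
  have hsign : ∀ᶠ x in 𝓝 a, SignType.sign (G x) = SignType.sign (G a) := by
    have h := (continuousAt_sign_of_ne_zero hGa).comp hG.continuous.continuousAt
    simpa only [ContinuousAt, nhds_discrete, Filter.tendsto_pure, Function.comp_apply] using h
  obtain ⟨e, he, ha, hV, heφ⟩ := exists_mem_contDiffGroupoid_coe_eq (φ := φ)
    (Filter.inter_mem hGne hsign)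
    (fun x hx => ((contDiffAt_id.sub contDiffAt_const).mul (hroot x hx.1)).contDiffWithinAt)
    (hφa.deriv.trans_ne (Real.rpow_pos_of_pos (abs_pos.mpr hGa) _).ne')
  refine ⟨e, he, ha, by simp [heφ, φ], heφ ▸ hφa.deriv, fun x hx => ?_⟩
  calc f x = SignType.sign (G a) * ((x - a) ^ p * |G x|) := by
        rw [hf, ← (hV hx).2, mul_left_comm, sign_mul_abs]
    _ = SignType.sign (G a) * φ x ^ p := by
        rw [mul_pow, ← Real.rpow_natCast (|G x| ^ _), ← Real.rpow_mul (abs_nonneg _),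
          one_div_mul_cancel (by exact_mod_cast hp), Real.rpow_one]
    _ = SignType.sign (G a) * e x ^ p := by rw [heφ]

end Diffeo

/-! ### Change of variables for densities -/

/-- The image under the change of coordinates `e` of the density `h x dx`, with `h` supported in the
domain of `e`; it vanishes outside the range of `e`. -/
def pushDensity (e : OpenPartialHomeomorph ℝ ℝ) (h : ℝ → ℂ) : ℝ → ℂ :=
  e.target.indicator fun u => |deriv e.symm u| • h (e.symm u)

section PushDensity

variable {e : OpenPartialHomeomorph ℝ ℝ} {h : ℝ → ℂ}

theorem pushDensity_apply {x : ℝ} (hx : x ∈ e.source) :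
    pushDensity e h (e x) = |deriv e.symm (e x)| • h x := by
  rw [pushDensity, Set.indicator_of_mem (e.map_source hx), e.left_inv hx]

theorem pushDensity_mul_comp (k : ℝ → ℂ) (u : ℝ) :
    pushDensity e (fun x => h x * k (e x)) u = pushDensity e h u * k u := by
  by_cases hu : u ∈ e.target
  · simp [pushDensity, hu, mul_assoc]
  · simp [pushDensity, hu]

theorem integral_pushDensity (he : e ∈ contDiffGroupoid ∞ 𝓘(ℝ, ℝ))
    (hh : Function.support h ⊆ e.source) : ∫ u, pushDensity e h u = ∫ x, h x := by
  rw [pushDensity, integral_indicator e.open_target.measurableSet,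
    ← integral_image_eq_integral_abs_deriv_smul e.open_target.measurableSet
      (fun u hu => (hasDerivAt_of_mem_contDiffGroupoid (StructureGroupoid.symm _ he)
        hu).hasDerivWithinAt) e.symm.injOn,
    e.symm_image_target_eq_source, setIntegral_eq_integral_of_forall_compl_eq_zero]
  exact fun x hx => Function.notMem_support.mp fun hx' => hx (hh hx')

theorem integral_pushDensity_mul (he : e ∈ contDiffGroupoid ∞ 𝓘(ℝ, ℝ))
    (hh : Function.support h ⊆ e.source) (k : ℝ → ℂ) :
    ∫ u, pushDensity e h u * k u = ∫ x, h x * k (e x) := by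
  have hsupp : (Function.support fun x => h x * k (e x)) ⊆ e.source := fun x hx =>
    hh (left_ne_zero_of_mul hx)
  rw [← integral_pushDensity he hsupp]
  simp only [pushDensity_mul_comp]

theorem tsupport_pushDensity_subset (hc : HasCompactSupport h) (hh : tsupport h ⊆ e.source) :
    tsupport (pushDensity e h) ⊆ e '' tsupport h := by
  have hK : IsCompact (e '' tsupport h) :=
    hc.isCompact.image_of_continuousOn (e.continuousOn.mono hh)
  refine closure_minimal (fun u hu => ?_) hK.isClosed
  have hut : u ∈ e.target := Set.mem_of_indicator_ne_zero hu
  rw [Function.mem_support, pushDensity, Set.indicator_of_mem hut] at hu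
  exact ⟨e.symm u, subset_tsupport h (right_ne_zero_of_smul hu), e.right_inv hut⟩

theorem pushDensity_mem_testFunctions (he : e ∈ contDiffGroupoid ∞ 𝓘(ℝ, ℝ))
    (hh : h ∈ testFunctions) (hs : tsupport h ⊆ e.source) :
    pushDensity e h ∈ testFunctions := by
  have hK := tsupport_pushDensity_subset hh.2 hs
  refine ⟨contMDiff_iff_contDiff.mp
    (contMDiff_of_tsupport fun u hu => contMDiffAt_iff_contDiffAt.mpr ?_),
    (hh.2.isCompact.image_of_continuousOn (e.continuousOn.mono hs)).of_isClosed_subset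
      (isClosed_tsupport _) hK⟩
  have hut : u ∈ e.target := (Set.image_mono hs).trans e.image_source_eq_target.subset (hK hu)
  have hsymm := mem_contDiffGroupoid_iff.mp (StructureGroupoid.symm _ he)
  have hderiv : ContDiffAt ℝ ∞ (deriv e.symm) u :=
    (hsymm.1.deriv_of_isOpen e.open_target (by simp)).contDiffAt (e.open_target.mem_nhds hut)
  have hsmooth : ContDiffAt ℝ ∞ (fun u => |deriv e.symm u| • h (e.symm u)) u :=
    ((contDiffAt_abs (deriv_symm_ne_zero he hut)).comp u hderiv).smul
      (hh.1.contDiffAt.comp u (hsymm.1.contDiffAt (e.open_target.mem_nhds hut)))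
  refine hsmooth.congr_of_eventuallyEq ?_
  filter_upwards [e.open_target.mem_nhds hut] with v hv using Set.indicator_of_mem hv _

end PushDensity

/-! ### Uniqueness of the Fourier transform -/

section FourierUniqueness

variable {X : Type*} [MeasurableSpace X] {ν : Measure X} {R : X → ℝ}

theorem charFun_map_withDensity_ofReal (hR : Measurable R) {g : X → ℝ} (hg : Integrable g ν)
    (t : ℝ) :
    charFun ((ν.withDensity fun x => ENNReal.ofReal (g x)).map R) t
      = ∫ x, Complex.exp (Complex.I * ((R x * t : ℝ) : ℂ)) * ((max (g x) 0 : ℝ) : ℂ) ∂ν := by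
  rw [charFun_apply_real, integral_map hR.aemeasurable (by fun_prop),
    integral_withDensity_eq_integral_toReal_smul₀ hg.aemeasurable.ennreal_ofReal
      (.of_forall fun _ => ENNReal.ofReal_lt_top)]
  refine integral_congr_ae (.of_forall fun x => ?_)
  simp only [ENNReal.toReal_ofReal', Complex.real_smul, Complex.ofReal_mul]
  ring_nf

theorem integrable_exp_mul (hR : Measurable R) {h : X → ℂ} (hi : Integrable h ν) (t : ℝ) :
    Integrable (fun x => Complex.exp (Complex.I * ((R x * t : ℝ) : ℂ)) * h x) ν :=
  hi.bdd_mul (c := 1) (Measurable.aestronglyMeasurable (by fun_prop))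
    (.of_forall fun x => by rw [mul_comm, Complex.norm_exp_ofReal_mul_I])

theorem setIntegral_preimage_eq_zero_of_real (hR : Measurable R) {g : X → ℝ}
    (hg : Integrable g ν)
    (H : ∀ t : ℝ, ∫ x, Complex.exp (Complex.I * ((R x * t : ℝ) : ℂ)) * (g x : ℂ) ∂ν = 0)
    {B : Set ℝ} (hB : MeasurableSet B) : ∫ x in R ⁻¹' B, g x ∂ν = 0 := by
  have hneg : Integrable (fun x => -g x) ν := hg.neg
  have hpart : ∀ {k : X → ℝ}, Integrable k ν → Integrable (fun x => ((max (k x) 0 : ℝ) : ℂ)) ν :=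
    fun hk => hk.pos_part.ofReal
  have := isFiniteMeasure_withDensity_ofReal hg.hasFiniteIntegral
  have := isFiniteMeasure_withDensity_ofReal hneg.hasFiniteIntegral
  have hμ : (ν.withDensity fun x => ENNReal.ofReal (g x)).map R
      = (ν.withDensity fun x => ENNReal.ofReal (-g x)).map R := by
    refine Measure.ext_of_charFun (funext fun t => sub_eq_zero.mp ?_)
    rw [charFun_map_withDensity_ofReal hR hg, charFun_map_withDensity_ofReal hR hneg,
      ← integral_sub (integrable_exp_mul hR (hpart hg) t)
        (integrable_exp_mul hR (hpart hneg) t), ← H t]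
    refine integral_congr_ae (.of_forall fun x => ?_)
    simp only [← mul_sub, ← Complex.ofReal_sub, max_zero_sub_max_neg_zero_eq_self]
  have hμB := congrArg (fun μ : Measure ℝ => (μ B).toReal) hμ
  simp only [Measure.map_apply hR hB, withDensity_apply _ (hR hB)] at hμB
  rw [integral_eq_lintegral_pos_part_sub_lintegral_neg_part hg.restrict, hμB, sub_self]

theorem integral_exp_mul_re_eq_zero (hR : Measurable R) {h : X → ℂ} (hi : Integrable h ν)
    (H : ∀ t : ℝ, ∫ x, Complex.exp (Complex.I * ((R x * t : ℝ) : ℂ)) * h x ∂ν = 0) (t : ℝ) :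
    ∫ x, Complex.exp (Complex.I * ((R x * t : ℝ) : ℂ)) * ((h x).re : ℂ) ∂ν = 0 := by
  have hconj : ∫ x, Complex.exp (Complex.I * ((R x * t : ℝ) : ℂ)) * starRingEnd ℂ (h x) ∂ν = 0 := by
    rw [← map_zero (starRingEnd ℂ), ← H (-t), ← integral_conj]
    refine integral_congr_ae (.of_forall fun x => ?_)
    simp [← Complex.exp_conj]
  have hci : Integrable (fun x => starRingEnd ℂ (h x)) ν :=
    Complex.conjLIE.integrable_comp_iff.mpr hi
  calc _ = ∫ x, (Complex.exp (Complex.I * ((R x * t : ℝ) : ℂ)) * h x +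
        Complex.exp (Complex.I * ((R x * t : ℝ) : ℂ)) * starRingEnd ℂ (h x)) / 2 ∂ν := by
        simp only [Complex.re_eq_add_conj, mul_div_assoc', mul_add]
    _ = 0 := by
        rw [integral_div, integral_add (integrable_exp_mul hR hi t) (integrable_exp_mul hR hci t),
          H t, hconj, add_zero, zero_div]

theorem setIntegral_preimage_eq_zero (hR : Measurable R) {h : X → ℂ} (hi : Integrable h ν)
    (H : ∀ t : ℝ, ∫ x, Complex.exp (Complex.I * ((R x * t : ℝ) : ℂ)) * h x ∂ν = 0)
    {B : Set ℝ} (hB : MeasurableSet B) : ∫ x in R ⁻¹' B, h x ∂ν = 0 := by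
  have hre : ∫ x in R ⁻¹' B, (h x).re ∂ν = 0 :=
    setIntegral_preimage_eq_zero_of_real hR hi.re (integral_exp_mul_re_eq_zero hR hi H) hB
  have him : ∫ x in R ⁻¹' B, (-Complex.I * h x).re ∂ν = 0 := by
    refine setIntegral_preimage_eq_zero_of_real hR (hi.const_mul (-Complex.I)).re
      (integral_exp_mul_re_eq_zero hR (hi.const_mul _) fun t => ?_) hB
    simp_rw [mul_left_comm _ (-Complex.I)]
    rw [integral_const_mul, H t, mul_zero]
  have hI : ∀ z : ℂ, (-Complex.I * z).re = z.im := fun z => by simp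
  simp only [hI] at him
  rw [← integral_re_add_im hi.restrict]
  simp [hre, him]

/-- The functions `R n` form a single function on the disjoint union of copies of `X`. -/
theorem sum_setIntegral_preimage_eq_zero {ι : Type*} [Countable ι] {s : Finset ι} {R : ι → X → ℝ}
    {h : ι → X → ℂ} (hR : ∀ n, Measurable (R n))
    (hi : ∀ n, Integrable (h n) ν)
    (H : ∀ t : ℝ, ∑ n ∈ s, ∫ x, Complex.exp (Complex.I * ((R n x * t : ℝ) : ℂ)) * h n x ∂ν = 0)
    {B : Set ℝ} (hB : MeasurableSet B) : ∑ n ∈ s, ∫ x in R n ⁻¹' B, h n x ∂ν = 0 := by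
  let _ : MeasurableSpace ι := ⊤
  have : DiscreteMeasurableSpace ι := ⟨fun _ => MeasurableSpace.measurableSet_top⟩
  let μ : Measure (ι × X) := ∑ n ∈ s, ν.map (Prod.mk n)
  have hemb : ∀ n : ι, MeasurableEmbedding (Prod.mk n : X → ι × X) := fun n =>
    measurableEmbedding_prodMk_left n
  have hint : ∀ F : ι × X → ℂ, (∀ n, Integrable (fun x => F (n, x)) ν) →
      Integrable F μ ∧ ∫ z, F z ∂μ = ∑ n ∈ s, ∫ x, F (n, x) ∂ν := by
    intro F hF
    have hF' : ∀ n ∈ s, Integrable F (ν.map (Prod.mk n)) := fun n _ =>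
      (hemb n).integrable_map_iff.mpr (hF n)
    refine ⟨integrable_finsetSum_measure.mpr hF', ?_⟩
    rw [integral_finsetSum_measure hF']
    exact Finset.sum_congr rfl fun n _ => (hemb n).integral_map _
  have hR' : Measurable fun z : ι × X => R z.1 z.2 := measurable_from_prod_countable_right hR
  have hB' : MeasurableSet ((fun z : ι × X => R z.1 z.2) ⁻¹' B) := hR' hB
  have hzero := setIntegral_preimage_eq_zero hR' (hint (fun z => h z.1 z.2) hi).1 (fun t => by
    rw [(hint _ fun n => integrable_exp_mul (hR n) (hi n) t).2, H t]) hB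
  rw [← integral_indicator hB', (hint _ fun n => (hi n).indicator (hR n hB)).2] at hzero
  rw [← hzero]
  refine Finset.sum_congr rfl fun n _ => ?_
  rw [← integral_indicator (hR n hB)]
  rfl

end FourierUniqueness

/-! ### Expansions in real powers at `0⁺` -/

/-- `D s` has, as `s → 0⁺`, an expansion into finitely many real powers of `s` up to an error
`o(s ^ θ)`, in which the coefficient of `s ^ θ` is `c`. The finitely supported function `a` assigns
to each exponent its coefficient. -/
def HasCoeff (θ : ℝ) (D : ℝ → ℂ) (c : ℂ) : Prop :=
  ∃ a : ℝ →₀ ℂ, a θ = c ∧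
    (fun s : ℝ => D s - a.sum fun e b => b * ((s ^ e : ℝ) : ℂ)) =o[𝓝[>] 0] fun s : ℝ => s ^ θ

section HasCoeff

variable {θ : ℝ} {D D' : ℝ → ℂ} {c c' : ℂ}

theorem hasCoeff_zero_of_isLittleO (h : D =o[𝓝[>] 0] fun s : ℝ => s ^ θ) : HasCoeff θ D 0 :=
  ⟨0, rfl, by simpa using h⟩

theorem hasCoeff_mul_rpow (θ e : ℝ) (b : ℂ) :
    HasCoeff θ (fun s => b * ((s ^ e : ℝ) : ℂ)) (if e = θ then b else 0) :=
  ⟨Finsupp.single e b, Finsupp.single_apply, by simp⟩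

theorem HasCoeff.add (h : HasCoeff θ D c) (h' : HasCoeff θ D' c') :
    HasCoeff θ (fun s => D s + D' s) (c + c') := by
  obtain ⟨a, rfl, h⟩ := h
  obtain ⟨a', rfl, h'⟩ := h'
  refine ⟨a + a', rfl, (h.add h').congr_left fun s => ?_⟩
  rw [Finsupp.sum_add_index' (by simp) (by intros; ring)]
  ring

theorem HasCoeff.congr' (h : HasCoeff θ D c) (hD : D =ᶠ[𝓝[>] 0] D') : HasCoeff θ D' c := by
  obtain ⟨a, ha, h⟩ := h
  exact ⟨a, ha, h.congr' (hD.mono fun s hs => by simp only [hs]) .rfl⟩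

theorem HasCoeff.sum {ι : Type*} (t : Finset ι) {D : ι → ℝ → ℂ} {c : ι → ℂ}
    (h : ∀ i ∈ t, HasCoeff θ (D i) (c i)) :
    HasCoeff θ (fun s => ∑ i ∈ t, D i s) (∑ i ∈ t, c i) := by
  classical
  induction t using Finset.induction_on with
  | empty => exact hasCoeff_zero_of_isLittleO (Asymptotics.isLittleO_zero _ _)
  | insert i t hi ih =>
    simp_rw [Finset.sum_insert hi]
    exact (h i (t.mem_insert_self i)).add (ih fun j hj => h j (Finset.mem_insert_of_mem hj))

theorem tendsto_rpow_nhdsGT_zero {e : ℝ} (he : 0 < e) :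
    Filter.Tendsto (fun s : ℝ => s ^ e) (𝓝[>] 0) (𝓝[>] 0) := by
  refine tendsto_nhdsWithin_iff.mpr ⟨?_, ?_⟩
  · have h := (Real.continuousAt_rpow_const 0 e (.inr he.le)).tendsto
    rw [Real.zero_rpow he.ne'] at h
    exact h.mono_left nhdsWithin_le_nhds
  · filter_upwards [self_mem_nhdsWithin] with s hs using Real.rpow_pos_of_pos hs _

theorem isBigO_rpow_rpow_nhdsGT_zero {e e' : ℝ} (h : e ≤ e') :
    (fun s : ℝ => s ^ e') =O[𝓝[>] 0] fun s : ℝ => s ^ e := by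
  refine Asymptotics.IsBigO.of_bound' ?_
  filter_upwards [Ioo_mem_nhdsGT (zero_lt_one' ℝ)] with s hs
  rw [Real.norm_of_nonneg (Real.rpow_nonneg hs.1.le _),
    Real.norm_of_nonneg (Real.rpow_nonneg hs.1.le _)]
  exact Real.rpow_le_rpow_of_exponent_ge hs.1 hs.2.le h

theorem tendsto_rpow_sum_div_rpow {a : ℝ →₀ ℂ} {m : ℝ} (hm : ∀ e ∈ a.support, m ≤ e) :
    Filter.Tendsto (fun s : ℝ => (a.sum fun e b => b * ((s ^ e : ℝ) : ℂ)) / ((s ^ m : ℝ) : ℂ))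
      (𝓝[>] 0) (𝓝 (a m)) := by
  have hlim : Filter.Tendsto (fun s : ℝ => a.sum fun e b => b * ((s ^ (e - m) : ℝ) : ℂ))
      (𝓝[>] 0) (𝓝 (∑ e ∈ a.support, if e = m then a e else 0)) := by
    refine tendsto_finsetSum _ fun e he => ?_
    split_ifs with hem
    · simp [hem]
    · have hlt : 0 < e - m := sub_pos.mpr ((hm e he).lt_of_ne' hem)
      simpa using ((Complex.continuous_ofReal.tendsto 0).comp
        ((tendsto_rpow_nhdsGT_zero hlt).mono_right nhdsWithin_le_nhds)).const_mul (a e)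
  rw [Finset.sum_ite_eq', ite_eq_left_iff.mpr fun h => (Finsupp.notMem_support_iff.mp h).symm]
    at hlim
  refine hlim.congr' ?_
  filter_upwards [self_mem_nhdsWithin] with s hs
  rw [Finsupp.sum, Finsupp.sum, Finset.sum_div]
  refine Finset.sum_congr rfl fun e _ => ?_
  rw [Real.rpow_sub hs, Complex.ofReal_div, mul_div_assoc]

theorem HasCoeff.eq_zero (h : HasCoeff θ 0 c) : c = 0 := by
  obtain ⟨a, rfl, h⟩ := h
  by_contra hne
  have hθ : θ ∈ a.support := Finsupp.mem_support_iff.mpr hne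
  let m := a.support.min' ⟨θ, hθ⟩
  have hsmall : (fun s : ℝ => a.sum fun e b => b * ((s ^ e : ℝ) : ℂ))
      =o[𝓝[>] 0] fun s : ℝ => ((s ^ m : ℝ) : ℂ) := by
    have h' := h.trans_isBigO (isBigO_rpow_rpow_nhdsGT_zero (a.support.min'_le θ hθ))
    simpa [Complex.isLittleO_ofReal_right] using h'
  have ham : a m = 0 := tendsto_nhds_unique
    (tendsto_rpow_sum_div_rpow fun e he => a.support.min'_le e he) hsmall.tendsto_div_nhds_zero
  exact Finsupp.mem_support_iff.mp (a.support.min'_mem _) ham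

/-- Taylor expansion at `0`, read in the variable `s = t ^ q`. -/
theorem hasCoeff_comp_rpow_inv {φ : ℝ → ℂ} (hφ : ContDiff ℝ ∞ φ) {q : ℕ} (hq : q ≠ 0)
    (hθ : θ ≤ 1) :
    HasCoeff θ (fun s => φ (s ^ (1 / (q : ℝ)))) (∑ k ∈ Finset.range (q + 1),
      if (k : ℝ) / q = θ then ((k.factorial : ℝ)⁻¹ : ℝ) • iteratedDeriv k φ 0 else 0) := by
  have hq' : (q : ℝ) ≠ 0 := Nat.cast_ne_zero.mpr hq
  have hpow : ∀ s : ℝ, 0 ≤ s → ∀ k : ℕ, (s ^ (1 / (q : ℝ))) ^ k = s ^ ((k : ℝ) / q) := by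
    intro s hs k
    rw [← Real.rpow_natCast, ← Real.rpow_mul hs, one_div_mul_eq_div]
  have hrest : (fun s : ℝ => φ (s ^ (1 / (q : ℝ))) -
      taylorWithinEval φ q Set.univ 0 (s ^ (1 / (q : ℝ)))) =o[𝓝[>] 0] fun s : ℝ => s ^ θ := by
    refine (((taylor_isLittleO_univ (hφ.of_le (by exact_mod_cast le_top))).comp_tendsto
      ((tendsto_rpow_nhdsGT_zero (by positivity)).mono_right nhdsWithin_le_nhds)).congr'
        .rfl ?_).trans_isBigO (isBigO_rpow_rpow_nhdsGT_zero hθ)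
    filter_upwards [self_mem_nhdsWithin] with s hs
    simp only [Function.comp_apply, sub_zero]
    rw [hpow s (le_of_lt hs), div_self hq']
  rw [← add_zero (Finset.sum _ _)]
  refine ((HasCoeff.sum (Finset.range (q + 1)) fun k _ => hasCoeff_mul_rpow θ ((k : ℝ) / q)
    (((k.factorial : ℝ)⁻¹ : ℝ) • iteratedDeriv k φ 0)).add
      (hasCoeff_zero_of_isLittleO hrest)).congr' ?_
  filter_upwards [self_mem_nhdsWithin] with s hs
  rw [taylor_within_apply, add_comm, sub_add_eq_add_sub, add_sub_assoc, add_eq_left, sub_eq_zero]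
  refine Finset.sum_congr rfl fun k _ => ?_
  rw [sub_zero, hpow s (le_of_lt hs), iteratedDerivWithin_univ, Complex.real_smul,
    Complex.real_smul]
  push_cast
  ring

end HasCoeff

/-! ### The mass of a density where a function is small and positive -/

/-- The mass which the density `h x dx` gives to the set where `0 < f < s`. -/
def sublevelMass (f : ℝ → ℝ) (h : ℝ → ℂ) (s : ℝ) : ℂ :=
  ∫ x in f ⁻¹' Set.Ioo 0 s, h x

/-- The number of sides of `0` on which `σ y ^ q` is positive. -/
def sideCount (σ : SignType) (q : ℕ) : ℕ :=
  (if σ = 1 then 1 else 0) + (if σ * (-1) ^ q = 1 then 1 else 0)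

theorem integrable_of_mem_testFunctions {h : ℝ → ℂ} (hh : h ∈ testFunctions) : Integrable h :=
  hh.1.continuous.integrable_of_hasCompactSupport hh.2

section Model

variable {σ : SignType} {p q : ℕ} {k : ℝ → ℂ}

theorem mul_pow_mem_Ioo_iff (hq : q ≠ 0) {y t : ℝ} (hy : 0 < y) (ht : 0 < t) :
    (σ : ℝ) * y ^ q ∈ Set.Ioo 0 (t ^ q) ↔ σ = 1 ∧ y < t := by
  have hyq : 0 < y ^ q := pow_pos hy q
  cases σ <;> simp [← pow_lt_pow_iff_left₀ hy.le ht.le hq, hyq, hyq.le]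

/-- The density `k y dy` folded onto `(0, ∞)` after deleting the sides of `0` on which `σ y ^ q` is
negative. -/
def foldedDensity (σ : SignType) (q : ℕ) (k : ℝ → ℂ) (y : ℝ) : ℂ :=
  (if σ = 1 then k y else 0) + if σ * (-1) ^ q = 1 then k (-y) else 0

theorem foldedDensity_zero : foldedDensity σ q k 0 = sideCount σ q * k 0 := by
  unfold foldedDensity sideCount
  split_ifs <;> simp [two_mul]

theorem contDiff_foldedDensity (hk : ContDiff ℝ ∞ k) : ContDiff ℝ ∞ (foldedDensity σ q k) := by
  unfold foldedDensity
  refine ContDiff.add ?_ ?_ <;> split_ifs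
  exacts [hk, contDiff_const, hk.comp contDiff_neg, contDiff_const]

theorem deriv_foldedDensity_zero_of_even (hq : Even q) : deriv (foldedDensity σ q k) 0 = 0 := by
  have heven : (fun y => foldedDensity σ q k (-y)) = foldedDensity σ q k := funext fun y => by
    simp only [foldedDensity, hq.neg_one_pow, mul_one, neg_neg, add_comm]
  have h := deriv_comp_neg (foldedDensity σ q k) 0
  rw [heven, neg_zero] at h
  exact self_eq_neg.mp h

theorem indicator_add_indicator_neg (hq : q ≠ 0) {y t : ℝ} (hy : 0 < y) (ht : 0 < t) :
    ((fun y : ℝ => (σ : ℝ) * y ^ q) ⁻¹' Set.Ioo 0 (t ^ q)).indicator k y +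
      ((fun y : ℝ => (σ : ℝ) * y ^ q) ⁻¹' Set.Ioo 0 (t ^ q)).indicator k (-y) =
      (Set.Iio t).indicator (foldedDensity σ q k) y := by
  classical
  have hneg : (σ : ℝ) * (-y) ^ q = ((σ * (-1) ^ q : SignType) : ℝ) * y ^ q := by
    rw [neg_pow, SignType.coe_mul, SignType.coe_pow, mul_assoc]
    simp
  simp only [Set.indicator_apply, Set.mem_preimage, hneg, mul_pow_mem_Ioo_iff hq hy ht,
    Set.mem_Iio, foldedDensity]
  by_cases hyt : y < t <;> simp [hyt]

theorem sublevelMass_mul_pow (hk : Integrable k) (hq : q ≠ 0) {t : ℝ} (ht : 0 < t) :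
    sublevelMass (fun y => σ * y ^ q) k (t ^ q) = ∫ y in 0..t, foldedDensity σ q k y := by
  have hmeas : MeasurableSet ((fun y : ℝ => (σ : ℝ) * y ^ q) ⁻¹' Set.Ioo 0 (t ^ q)) :=
    measurableSet_Ioo.preimage (by fun_prop)
  let F : ℝ → ℂ := ((fun y : ℝ => (σ : ℝ) * y ^ q) ⁻¹' Set.Ioo 0 (t ^ q)).indicator k
  have hF : Integrable F := hk.indicator hmeas
  calc sublevelMass (fun y => σ * y ^ q) k (t ^ q) = ∫ y, F y := (integral_indicator hmeas).symm
    _ = ∫ y in Set.Ioi 0, (F y + F (-y)) := by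
        rw [integral_add hF.integrableOn hF.comp_neg.integrableOn, integral_comp_neg_Ioi, neg_zero,
          add_comm, intervalIntegral.integral_Iic_add_Ioi hF.integrableOn hF.integrableOn]
    _ = _ := by
        rw [setIntegral_congr_fun measurableSet_Ioi
            fun y hy => indicator_add_indicator_neg hq hy ht,
          setIntegral_indicator measurableSet_Iio, Set.Ioi_inter_Iio,
          ← integral_Ioc_eq_integral_Ioo, intervalIntegral.integral_of_le ht.le]

theorem sum_range_ite_div_eq (c : ℕ → ℂ) (hp : p ≠ 0) (hq : q ≠ 0) :
    (∑ j ∈ Finset.range (q + 1), if (j : ℝ) / q = 1 / (p : ℝ) then c j else 0) =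
      if p ∣ q then c (q / p) else 0 := by
  have hiff : ∀ j : ℕ, (j : ℝ) / q = 1 / p ↔ q = p * j := fun j => by
    rw [div_eq_div_iff (by positivity) (by positivity), one_mul, mul_comm, eq_comm]
    norm_cast
  simp_rw [hiff]
  split_ifs with hpq
  · obtain ⟨j, rfl⟩ := hpq
    rw [Nat.mul_div_cancel_left j (Nat.pos_of_ne_zero hp), Finset.sum_eq_single j]
    · simp
    · exact fun i _ hi => if_neg fun h => hi (Nat.eq_of_mul_eq_mul_left (by positivity) h).symm
    · exact fun hj => absurd (Finset.mem_range.mpr (by nlinarith [Nat.pos_of_ne_zero hp])) hj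
  · exact Finset.sum_eq_zero fun j _ => if_neg fun h => hpq ⟨j, h⟩

theorem hasCoeff_sublevelMass_mul_pow (hk : k ∈ testFunctions) (hp : p ≠ 0) (hq : q ≠ 0)
    (hpq : p ∣ q → q ≤ 2 * p) :
    HasCoeff (1 / (p : ℝ)) (sublevelMass (fun y => σ * y ^ q) k)
      (if q = p then sideCount σ q * k 0 else 0) := by
  let M : ℝ → ℂ := fun t => ∫ y in 0..t, foldedDensity σ q k y
  have hm : ContDiff ℝ ∞ (foldedDensity σ q k) := contDiff_foldedDensity hk.1
  have hM' : deriv M = foldedDensity σ q k := funext fun t => hm.continuous.deriv_integral _ 0 t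
  have hM : ContDiff ℝ ∞ M := contDiff_infty_iff_deriv.mpr
    ⟨fun t => (hm.continuous.integral_hasStrictDerivAt 0 t).hasDerivAt.differentiableAt, hM' ▸ hm⟩
  have hp1 : 1 / (p : ℝ) ≤ 1 := by
    rw [div_le_one (by positivity)]
    exact_mod_cast Nat.one_le_iff_ne_zero.mpr hp
  have hcoeff := hasCoeff_comp_rpow_inv hM hq hp1
  rw [sum_range_ite_div_eq _ hp hq] at hcoeff
  convert hcoeff.congr' ?_ using 1
  · by_cases hdvd : p ∣ q
    · obtain ⟨j, rfl⟩ := hdvd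
      have hj : j ≤ 2 := Nat.le_of_mul_le_mul_left
        ((hpq ⟨j, rfl⟩).trans_eq (mul_comm 2 p)) (Nat.pos_of_ne_zero hp)
      obtain rfl | rfl : j = 1 ∨ j = 2 := by
        have := right_ne_zero_of_mul hq
        omega
      · simp [Nat.div_self (Nat.pos_of_ne_zero hp), hM', foldedDensity_zero]
      · have hderiv : deriv (foldedDensity σ (p * 2) k) 0 = 0 :=
          deriv_foldedDensity_zero_of_even (even_two.mul_left p)
        rw [if_pos (dvd_mul_right p 2), Nat.mul_div_cancel_left 2 (Nat.pos_of_ne_zero hp),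
          iteratedDeriv_succ, iteratedDeriv_one, hM', hderiv, smul_zero, if_neg (by omega)]
    · rw [if_neg hdvd, if_neg fun h => hdvd h.symm.dvd]
  · filter_upwards [self_mem_nhdsWithin] with s hs
    have hsq : (s ^ (1 / (q : ℝ))) ^ q = s := by
      rw [one_div, Real.rpow_inv_natCast_pow (le_of_lt hs) hq]
    have h := sublevelMass_mul_pow (σ := σ) (integrable_of_mem_testFunctions hk) hq
      (Real.rpow_pos_of_pos hs (1 / (q : ℝ)))
    rw [hsq] at h
    exact h.symm

end Model

section Local

variable {f : ℝ → ℝ} {h : ℝ → ℂ} {z : ℝ} {p q : ℕ}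

theorem sublevelMass_pushDensity {e : OpenPartialHomeomorph ℝ ℝ}
    (he : e ∈ contDiffGroupoid ∞ 𝓘(ℝ, ℝ)) (hh : Function.support h ⊆ e.source) {g : ℝ → ℝ}
    (hf : Continuous f) (hg : Continuous g) (hfg : ∀ x ∈ e.source, f x = g (e x)) :
    sublevelMass g (pushDensity e h) = sublevelMass f h := by
  classical
  funext s
  rw [sublevelMass, sublevelMass, ← integral_indicator (measurableSet_Ioo.preimage hf.measurable),
    ← integral_indicator (measurableSet_Ioo.preimage hg.measurable)]
  have hpush := integral_pushDensity_mul he hh ((g ⁻¹' Set.Ioo 0 s).indicator 1)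
  simp only [← Set.indicator_mul_right _ (pushDensity e h), Pi.one_apply, mul_one] at hpush
  rw [hpush]
  refine integral_congr_ae (.of_forall fun x => ?_)
  by_cases hx : x ∈ e.source
  · simp [Set.indicator_apply, hfg x hx]
  · simp [Set.indicator_apply, Function.notMem_support.mp fun hx' => hx (hh hx')]

theorem exists_hasCoeff_sublevelMass {G : ℝ → ℝ} (hG : ContDiff ℝ ∞ G) (hq : q ≠ 0)
    (hf : ∀ x, f x = (x - z) ^ q * G x) (hGz : G z ≠ 0) :
    ∃ U ∈ 𝓝 z, ∀ h ∈ testFunctions, tsupport h ⊆ U → ∀ p ≠ 0, (p ∣ q → q ≤ 2 * p) →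
      HasCoeff (1 / (p : ℝ)) (sublevelMass f h)
        ((if q = p then sideCount (SignType.sign (G z)) q / ((|G z| ^ (1 / (q : ℝ)) : ℝ) : ℂ)
          else 0) * h z) := by
  obtain ⟨e, he, hz, hez, hderiv, hfe⟩ := exists_normalForm hG hq hf hGz
  refine ⟨e.source, e.open_source.mem_nhds hz, fun h hh hs p hp hpq => ?_⟩
  have hfc : Continuous f := by
    rw [funext hf]
    exact ((continuous_id.sub continuous_const).pow q).mul hG.continuous
  have hpush : pushDensity e h 0 = h z / ((|G z| ^ (1 / (q : ℝ)) : ℝ) : ℂ) := by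
    have hinv := deriv_symm_mul_deriv he hz
    have hpos : 0 < |G z| ^ (1 / (q : ℝ)) := Real.rpow_pos_of_pos (abs_pos.mpr hGz) _
    rw [← hez, pushDensity_apply hz, eq_inv_of_mul_eq_one_left hinv, hderiv,
      abs_of_pos (inv_pos.mpr hpos), Complex.real_smul, Complex.ofReal_inv, inv_mul_eq_div]
  have hmodel : Continuous fun y : ℝ => (SignType.sign (G z) : ℝ) * y ^ q := by fun_prop
  rw [← sublevelMass_pushDensity he ((subset_tsupport h).trans hs) hfc hmodel hfe, ite_mul,
    zero_mul, div_mul_eq_mul_div, mul_div_assoc, ← hpush]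
  exact hasCoeff_sublevelMass_mul_pow (pushDensity_mem_testFunctions he hh hs) hp hq hpq

end Local

section Global

variable {f : ℝ → ℝ} {h w : ℝ → ℂ} {θ : ℝ}

theorem mul_mem_testFunctions (hw : ContDiff ℝ ∞ w) (hh : h ∈ testFunctions) :
    w * h ∈ testFunctions :=
  ⟨hw.mul hh.1, hh.2.mul_left⟩

theorem exists_testFunction_eventuallyEq_one {z : ℝ} {U : Set ℝ} (hU : U ∈ 𝓝 z) :
    ∃ w ∈ testFunctions, tsupport w ⊆ U ∧ w =ᶠ[𝓝 z] 1 := by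
  obtain ⟨r, hr, hrU⟩ := Metric.nhds_basis_closedBall.mem_iff.mp hU
  let b : ContDiffBump z := ⟨r / 2, r, half_pos hr, half_lt_self hr⟩
  have hsupp : tsupport (fun x => (b x : ℂ)) ⊆ tsupport b :=
    closure_mono fun x hx => Complex.ofReal_ne_zero.mp hx
  refine ⟨fun x => (b x : ℂ), ⟨Complex.ofRealCLM.contDiff.comp b.contDiff,
    b.hasCompactSupport.of_isClosed_subset (isClosed_tsupport _) hsupp⟩,
    hsupp.trans (b.tsupport_eq.trans_subset hrU), b.eventuallyEq_one.mono fun x hx => ?_⟩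
  simp only [hx, Pi.one_apply, Complex.ofReal_one]

theorem sublevelMass_add {h' : ℝ → ℂ} (hh : Integrable h) (hh' : Integrable h') (s : ℝ) :
    sublevelMass f (h + h') s = sublevelMass f h s + sublevelMass f h' s :=
  integral_add hh.integrableOn hh'.integrableOn

theorem sublevelMass_eventuallyEq_zero (hf : Continuous f) (hh : HasCompactSupport h)
    (hfh : ∀ x ∈ tsupport h, f x ≠ 0) : sublevelMass f h =ᶠ[𝓝[>] 0] 0 := by
  have hK : IsCompact (f '' tsupport h) := hh.isCompact.image hf
  have h0 : (f '' tsupport h)ᶜ ∈ 𝓝 0 :=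
    hK.isClosed.isOpen_compl.mem_nhds fun ⟨x, hx, hx0⟩ => hfh x hx hx0
  obtain ⟨ε, hε, hball⟩ := Metric.mem_nhds_iff.mp h0
  filter_upwards [Ioo_mem_nhdsGT hε] with s hs
  refine setIntegral_eq_zero_of_forall_eq_zero fun x hx =>
    image_eq_zero_of_notMem_tsupport fun hxh => hball ?_ (Set.mem_image_of_mem f hxh)
  rw [Metric.mem_ball, Real.dist_0_eq_abs, abs_of_pos hx.1]
  exact hx.2.trans hs.2

theorem hasCoeff_sublevelMass_sum (hf : Continuous f) {c : ℝ → ℂ} (Z : Finset ℝ)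
    (hloc : ∀ z ∈ Z, ∃ U ∈ 𝓝 z, ∀ h ∈ testFunctions, tsupport h ⊆ U →
      HasCoeff θ (sublevelMass f h) (c z * h z))
    (hh : h ∈ testFunctions) (hZ : ∀ x ∈ tsupport h, f x = 0 → x ∈ Z) :
    HasCoeff θ (sublevelMass f h) (∑ z ∈ Z, c z * h z) := by
  induction Z using Finset.induction_on generalizing h with
  | empty =>
    have hzero := sublevelMass_eventuallyEq_zero hf hh.2 fun x hx hx0 => by simpa using hZ x hx hx0
    exact (hasCoeff_zero_of_isLittleO (Asymptotics.isLittleO_zero _ _)).congr' hzero.symm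
  | insert z Z hz ih =>
    obtain ⟨U, hU, hUc⟩ := hloc z (Z.mem_insert_self z)
    obtain ⟨w, hw, hws, hwz⟩ := exists_testFunction_eventuallyEq_one
      (Filter.inter_mem hU (Z.finite_toSet.isClosed.isOpen_compl.mem_nhds hz))
    have hwZ : ∀ x ∈ Z, w x = 0 := fun x hx =>
      image_eq_zero_of_notMem_tsupport fun hxw => (hws hxw).2 hx
    have h₁ : w * h ∈ testFunctions := mul_mem_testFunctions hw.1 hh
    have h₂ : (1 - w) * h ∈ testFunctions := mul_mem_testFunctions (contDiff_const.sub hw.1) hh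
    have hcoeff₁ := hUc (w * h) h₁ ((tsupport_mul_subset_left).trans
      (hws.trans Set.inter_subset_left))
    have hcoeff₂ := ih (fun x hx => hloc x (Finset.mem_insert_of_mem hx)) h₂ fun x hx hx0 => by
      refine (Finset.mem_insert.mp (hZ x (tsupport_mul_subset_right hx) hx0)).resolve_left ?_
      rintro rfl
      refine notMem_tsupport_iff_eventuallyEq.mpr ?_ hx
      filter_upwards [hwz] with y hy
      simp [hy]
    rw [Finset.sum_insert hz]
    convert (hcoeff₁.add hcoeff₂).congr' (.of_forall fun s => ?_) using 2
    · simp [hwz.self_of_nhds]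
    · exact Finset.sum_congr rfl fun x hx => by simp [hwZ x hx]
    · beta_reduce
      rw [← sublevelMass_add (integrable_of_mem_testFunctions h₁)
        (integrable_of_mem_testFunctions h₂), ← add_mul, add_sub_cancel, one_mul]

end Global

/-! ### Components of the vectors in `Φ` -/

section TestSpace

variable {S : ScalingData}

theorem comp_components_symm_single (m : ℤ) (ψ : testFunctions) (n : ℤ) (x : ℝ) :
    comp S ((components S).symm (Finsupp.single m ψ)) n x = if m = n then ψ.1 x else 0 := by
  rw [comp, LinearEquiv.apply_symm_apply, Finsupp.single_apply]
  split_ifs <;> rfl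

theorem coe_components_symm_single (m : ℤ) (ψ : testFunctions) :
    ((components S).symm (Finsupp.single m ψ) : Haux) = mode S m ψ := by
  change synth S (Finsupp.single m ψ) = mode S m ψ
  simp only [synth, Finsupp.lsum_single]

theorem inner_mode_testSpace (m : ℤ) (ψ : testFunctions) (f : testSpace S) :
    inner ℂ (mode S m ψ) (f : Haux) = ∫ x, starRingEnd ℂ (ψ.1 x) * comp S f m x := by
  obtain ⟨F, rfl⟩ := (components S).symm.surjective f
  rw [comp, LinearEquiv.apply_symm_apply]
  exact inner_mode_synth S m ψ F

theorem coe_eq_sum_mode (f : testSpace S) :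
    (f : Haux) = (components S f).sum fun n ψ => mode S n ψ := by
  obtain ⟨F, rfl⟩ := (components S).symm.surjective f
  rw [LinearEquiv.apply_symm_apply]
  rfl

theorem comp_gaugeTest (t : ℝ) (f : testSpace S) (n : ℤ) (x : ℝ) :
    comp S (gaugeTest S t f) n x
      = Complex.exp (Complex.I * ((S.R n x * t : ℝ) : ℂ)) * comp S f n x := by
  obtain ⟨F, rfl⟩ := (components S).symm.surjective f
  induction F using Finsupp.induction_linear with
  | zero => simp [comp]
  | add F G hF hG =>
    simp only [comp, map_add, Finsupp.add_apply, Submodule.coe_add, Pi.add_apply, mul_add] at *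
    rw [hF, hG]
  | single m ψ =>
    have h : gaugeTest S t ((components S).symm (Finsupp.single m ψ))
        = (components S).symm (Finsupp.single m (phaseMul S t m ψ)) := by
      refine Subtype.ext ?_
      rw [coe_components_symm_single, ← gauge_mode, ← coe_components_symm_single]
      rfl
    rw [h, comp_components_symm_single, comp_components_symm_single]
    split_ifs with hmn
    · subst hmn
      rfl
    · rw [mul_zero]

/-- The functional `g ↦ g_n(x)` on `Φ` at the point `z = (n, x)`. -/
def evalAt (S : ScalingData) (z : ℤ × ℝ) : Module.Dual ℂ (testSpace S) where
  toFun g := comp S g z.1 z.2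
  map_add' f g := by simp [comp]
  map_smul' c f := by simp [comp]

theorem evalAt_apply (z : ℤ × ℝ) (g : testSpace S) : evalAt S z g = comp S g z.1 z.2 := rfl

/-- The componentwise product `n ↦ conj (f_n) g_n`, whose integrals against `e^{i R_n t}` are the
matrix elements of the gauge group. -/
def pairing (f g : testSpace S) : ℤ →₀ testFunctions :=
  Finsupp.onFinset (components S f).support
    (fun n => ⟨fun x => starRingEnd ℂ (comp S f n x) * comp S g n x,
      (Complex.conjCLE.contDiff.comp (components S f n).2.1).mul (components S g n).2.1,
      (components S g n).2.2.mul_left⟩)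
    fun n hn => Finsupp.mem_support_iff.mpr fun h0 => hn (Subtype.ext (funext fun x => by
      simp [comp, h0]))

theorem pairing_apply (f g : testSpace S) (z : ℤ × ℝ) :
    (pairing f g z.1).1 z.2 = starRingEnd ℂ (evalAt S z f) * evalAt S z g := rfl

/-- The integral of `e^{i R_n(x) t} h_n(x)` over all `n` and `x`, for finitely many test functions
`h_n`: the Fourier transform at `t` of the sum of the images of the measures `h_n dx` under the
`R_n`. -/
def gaugeTransform (S : ScalingData) (t : ℝ) (H : ℤ →₀ testFunctions) : ℂ :=
  H.sum fun n h => ∫ x, Complex.exp (Complex.I * ((S.R n x * t : ℝ) : ℂ)) * h.1 x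

theorem continuous_R (S : ScalingData) (n : ℤ) : Continuous (S.R n) :=
  (continuous_const.sub S.α_smooth.continuous).mul S.N_smooth.continuous

theorem gaugeTransform_sub (t : ℝ) (H K : ℤ →₀ testFunctions) :
    gaugeTransform S t (H - K) = gaugeTransform S t H - gaugeTransform S t K := by
  refine Finsupp.sum_sub_index fun n h k => ?_
  rw [← integral_sub (integrable_exp_mul (continuous_R S n).measurable
      (integrable_of_mem_testFunctions h.2) t) (integrable_exp_mul (continuous_R S n).measurable
      (integrable_of_mem_testFunctions k.2) t)]
  simp_rw [← mul_sub]
  rfl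

theorem inner_gaugeTest_neg (t : ℝ) (f g : testSpace S) :
    inner ℂ (gaugeTest S (-t) f : Haux) (g : Haux) = gaugeTransform S t (pairing f g) := by
  have h : (gaugeTest S (-t) f : Haux)
      = (components S f).sum fun n ψ => mode S n (phaseMul S (-t) n ψ) := by
    change gauge S (-t) (f : Haux) = _
    rw [coe_eq_sum_mode f, Finsupp.sum, map_sum]
    simp_rw [gauge_mode]
    rfl
  rw [h, gaugeTransform, pairing, Finsupp.onFinset_sum _ fun n => by simp, Finsupp.sum, sum_inner]
  refine Finset.sum_congr rfl fun n _ => ?_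
  rw [inner_mode_testSpace]
  refine integral_congr_ae (.of_forall fun x => ?_)
  simp only [phaseMul, map_mul, ← Complex.exp_conj, mul_assoc]
  simp [comp]

theorem Observable.inner_act (A : Observable S) (f g : testSpace S) :
    inner ℂ (A.act f : Haux) (g : Haux) = inner ℂ (f : Haux) (A.adjAct g : Haux) := by
  have h : inner ℂ (A.adjAct g : Haux) (f : Haux) = inner ℂ (g : Haux) (A.act f : Haux) :=
    LinearPMap.adjoint_isFormalAdjoint A.dense ⟨g, A.le_adjoint_domain g.2⟩ ⟨f, A.le_domain f.2⟩
  rw [← inner_conj_symm, ← h, inner_conj_symm]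

theorem Observable.gaugeTransform_pairing_sub (A : Observable S) (f g : testSpace S) (t : ℝ) :
    gaugeTransform S t (pairing (A.act f) g - pairing f (A.adjAct g)) = 0 := by
  have hcomm : gaugeTest S (-t) (A.act f) = A.act (gaugeTest S (-t) f) :=
    Subtype.ext (A.commutes (-t) f).symm
  rw [gaugeTransform_sub, ← inner_gaugeTest_neg, ← inner_gaugeTest_neg, hcomm, A.inner_act,
    sub_self]

end TestSpace

/-! ### Forms given by point-finite families of functionals -/

section WeightedForm

variable {ι V : Type*} [AddCommGroup V] [Module ℂ V] {e : ι → Module.Dual ℂ V}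

/-- A family of functionals, only finitely many of which are nonzero at any given vector. -/
def PointFinite (e : ι → Module.Dual ℂ V) : Prop :=
  ∀ f, (Function.support fun i => e i f).Finite

theorem PointFinite.finite_support (he : PointFinite e) (f : V) {k : ι → ℂ}
    (hk : ∀ i, e i f = 0 → k i = 0) : (Function.support k).Finite :=
  (he f).subset fun i hi h0 => hi (hk i h0)

/-- The sesquilinear form `(f, g) ↦ ∑ conj (e_i f) (e_i g) / w_i` of a point-finite family of
functionals `e_i` with weights `w_i`, as an antilinear map into the dual. -/
def weightedForm (he : PointFinite e) (w : ι → ℝ) : V →ₛₗ[starRingEnd ℂ] Module.Dual ℂ V :=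
  LinearMap.mk₂'ₛₗ (starRingEnd ℂ) (RingHom.id ℂ)
    (fun f g => ∑ᶠ i, starRingEnd ℂ (e i f) * e i g / (w i : ℂ))
    (fun f f' g => by
      rw [← finsum_add_distrib (he.finite_support g fun i h => by simp [h])
        (he.finite_support g fun i h => by simp [h])]
      simp only [map_add, add_mul, add_div])
    (fun c f g => by
      simp only [map_smul, smul_eq_mul, map_mul, mul_assoc, mul_div_assoc, mul_finsum])
    (fun f g g' => by
      rw [← finsum_add_distrib (he.finite_support f fun i h => by simp [h])
        (he.finite_support f fun i h => by simp [h])]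
      simp only [map_add, mul_add, add_div])
    (fun c f g => by
      simp only [map_smul, smul_eq_mul, mul_left_comm _ c, mul_div_assoc, mul_finsum,
        RingHom.id_apply])

variable (he : PointFinite e) (w : ι → ℝ)

theorem weightedForm_apply (f g : V) :
    weightedForm he w f g = ∑ᶠ i, starRingEnd ℂ (e i f) * e i g / (w i : ℂ) := rfl

theorem conj_weightedForm (f g : V) :
    starRingEnd ℂ (weightedForm he w g f) = weightedForm he w f g := by
  rw [weightedForm_apply, weightedForm_apply]
  refine ((starRingEnd ℂ).toAddMonoidHom.map_finsum
    (he.finite_support f fun i h => by simp [h])).trans (finsum_congr fun i => ?_)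
  simp only [RingHom.toAddMonoidHom_eq_coe, AddMonoidHom.coe_coe, map_div₀, map_mul,
    Complex.conj_conj, Complex.conj_ofReal, mul_comm]

theorem weightedForm_self (f : V) :
    weightedForm he w f f = ((∑ᶠ i, ‖e i f‖ ^ 2 / w i : ℝ) : ℂ) := by
  have hfin : (Function.support fun i => ‖e i f‖ ^ 2 / w i).Finite :=
    (he f).subset fun i hi h0 => hi (by simp only at h0; simp [h0])
  refine Eq.trans (finsum_congr fun i => ?_) (Complex.ofRealHom.toAddMonoidHom.map_finsum hfin).symm
  simp [Complex.conj_mul']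

theorem weightedForm_eq_single {i : ι} (f : V) {g : V} (hg : ∀ j ≠ i, e j g = 0) :
    weightedForm he w f g = starRingEnd ℂ (e i f) * e i g / (w i : ℂ) :=
  finsum_eq_single _ i fun j hj => by rw [hg j hj, mul_zero, zero_div]

theorem range_weightedForm_le {W : Submodule ℂ (Module.Dual ℂ V)} (hW : ∀ i, e i ∈ W) :
    LinearMap.range (weightedForm he w) ≤ W := by
  rintro _ ⟨f, rfl⟩
  have h : weightedForm he w f
      = ∑ i ∈ (he f).toFinset, (starRingEnd ℂ (e i f) / (w i : ℂ)) • e i := by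
    refine LinearMap.ext fun g => ?_
    rw [weightedForm_apply, finsum_eq_sum_of_support_subset (s := (he f).toFinset) _ fun i hi => by
      simpa using fun h0 => hi (by simp [h0]), LinearMap.sum_apply]
    refine Finset.sum_congr rfl fun i _ => ?_
    rw [LinearMap.smul_apply, smul_eq_mul, div_mul_eq_mul_div]
  rw [h]
  exact W.sum_mem fun i _ => W.smul_mem _ (hW i)

theorem mem_of_dualMap_weightedForm_mem {W : Submodule ℂ (Module.Dual ℂ V)} {f : V} {i j : ι}
    (hw : w i ≠ 0) (hf : e i f ≠ 0) {E : V →ₗ[ℂ] V} (hi : ∀ g, e i (E g) = e j g)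
    (hE : ∀ k ≠ i, ∀ g, e k (E g) = 0) (hW : E.dualMap (weightedForm he w f) ∈ W) : e j ∈ W := by
  set c : ℂ := starRingEnd ℂ (e i f) / (w i : ℂ) with hc
  have hc0 : c ≠ 0 :=
    div_ne_zero ((map_ne_zero (starRingEnd ℂ)).mpr hf) (Complex.ofReal_ne_zero.mpr hw)
  have h : E.dualMap (weightedForm he w f) = c • e j := by
    refine LinearMap.ext fun g => ?_
    rw [LinearMap.dualMap_apply, weightedForm_eq_single he w f fun k hk => hE k hk g, hi,
      LinearMap.smul_apply, smul_eq_mul, hc, div_mul_eq_mul_div]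
  rw [h] at hW
  exact (W.smul_mem_iff hc0).mp hW

end WeightedForm

/-! ### The zeros of the `R_n` -/

section Zeros

variable {S : ScalingData} {p : ℕ} {z : ℤ × ℝ}

theorem R_eq_zero_iff {n : ℤ} {x : ℝ} : S.R n x = 0 ↔ S.α x = n := by
  rw [ScalingData.R, mul_eq_zero, or_iff_left (S.N_pos x).ne', sub_eq_zero, eq_comm]

theorem mem_integerSet_of_R_eq_zero {n : ℤ} {x : ℝ} (h : S.R n x = 0) : x ∈ integerSet S :=
  ⟨n, R_eq_zero_iff.mp h⟩

theorem ConditionB'.finite_inter (hb : ConditionB' S) {K : Set ℝ} (hK : IsCompact K) :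
    (integerSet S ∩ K).Finite := by
  by_contra hinf
  obtain ⟨x, -, hx⟩ := Set.Infinite.exists_accPt_of_subset_isCompact hinf hK Set.inter_subset_right
  exact hb.2.2.1 x (hx.mono (Filter.principal_mono.mpr Set.inter_subset_left))

theorem ConditionB'.exists_hasOrder (hb : ConditionB' S) {x : ℝ} (hx : x ∈ integerSet S) :
    ∃ q, HasOrder S q x := by
  classical
  have h := hb.2.2.2 x hx
  refine ⟨Nat.find h, (Nat.find_spec h).1, fun k hk hkq => ?_, (Nat.find_spec h).2⟩
  by_contra hne
  exact Nat.find_min h hkq ⟨hk, hne⟩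

theorem ConditionB'.finite_zeros (hb : ConditionB' S) (H : ℤ →₀ testFunctions) :
    {z : ℤ × ℝ | S.R z.1 z.2 = 0 ∧ (H z.1).1 z.2 ≠ 0}.Finite := by
  have hK : IsCompact (⋃ n ∈ H.support, tsupport (H n).1) :=
    H.support.isCompact_biUnion fun n _ => (H n).2.2.isCompact
  refine (H.support.finite_toSet.prod (hb.finite_inter hK)).subset ?_
  rintro ⟨n, x⟩ ⟨hR, hne⟩
  have hn : n ∈ H.support := Finsupp.mem_support_iff.mpr fun h0 => hne (by rw [h0]; rfl)
  exact ⟨hn, mem_integerSet_of_R_eq_zero hR, Set.mem_biUnion hn (subset_tsupport _ hne)⟩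

theorem HasOrder.unique {q : ℕ} {x : ℝ} (hp : HasOrder S p x) (hq : HasOrder S q x) : p = q := by
  rcases lt_trichotomy p q with h | h | h
  · exact absurd (hq.2.1 p hp.1 h) hp.2.2
  · exact h
  · exact absurd (hp.2.1 q hq.1 h) hq.2.2

/-- The weight `|α⁽ᵖ⁾(x) N(x)| ^ (1/p)` of a zero `x` of order `p`. -/
def weight (S : ScalingData) (p : ℕ) (x : ℝ) : ℝ :=
  |iteratedDeriv p S.α x * S.N x| ^ (1 / (p : ℝ))

theorem HasOrder.weight_pos {x : ℝ} (hp : HasOrder S p x) : 0 < weight S p x :=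
  Real.rpow_pos_of_pos (abs_pos.mpr (mul_ne_zero hp.2.2 (S.N_pos x).ne')) _

theorem exists_R_eq_pow_mul (hz : z ∈ zeros S p) :
    ∃ G : ℝ → ℝ, ContDiff ℝ ∞ G ∧ (∀ y, S.R z.1 y = (y - z.2) ^ p * G y) ∧
      G z.2 = -(iteratedDeriv p S.α z.2 * S.N z.2) / p.factorial := by
  obtain ⟨hR, hp, hlow, -⟩ := hz
  have hderiv : ∀ k, 1 ≤ k →
      iteratedDeriv k (fun y => (z.1 : ℝ) - S.α y) z.2 = -iteratedDeriv k S.α z.2 := fun k hk => by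
    rw [iteratedDeriv_const_sub hk, iteratedDeriv_neg]
  have h0 : ∀ k < p, iteratedDeriv k (fun y => (z.1 : ℝ) - S.α y) z.2 = 0 := by
    intro k hk
    rcases k.eq_zero_or_pos with rfl | hk0
    · rw [iteratedDeriv_zero, R_eq_zero_iff.mp hR, sub_self]
    · rw [hderiv k hk0, hlow k hk0 hk, neg_zero]
  obtain ⟨G, hG, hfG, hGz⟩ := exists_eq_pow_smul (contDiff_const.sub S.α_smooth) h0
  refine ⟨fun y => G y * S.N y, hG.mul S.N_smooth, fun y => ?_, ?_⟩
  · rw [ScalingData.R, hfG, smul_eq_mul, mul_assoc]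
  · simp only [hGz, hderiv p hp, smul_eq_mul]
    ring

/-- The sign of `R_n` immediately to the right of a zero `x` of order `p`. -/
def rightSign (S : ScalingData) (p : ℕ) (x : ℝ) : SignType :=
  -SignType.sign (iteratedDeriv p S.α x)

theorem rightSign_ne_zero (hz : z ∈ zeros S p) : rightSign S p z.2 ≠ 0 := by
  rw [rightSign, ← Left.sign_neg, Ne, sign_eq_zero_iff, neg_eq_zero]
  exact hz.2.2.2

theorem sign_neg_mul_div_factorial (x : ℝ) :
    SignType.sign (-(iteratedDeriv p S.α x * S.N x) / p.factorial) = rightSign S p x := by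
  have hpos : 0 < S.N x / p.factorial := div_pos (S.N_pos x) (by positivity)
  rw [← neg_mul, mul_div_assoc, sign_mul, sign_pos hpos, mul_one, Left.sign_neg, rightSign]

theorem exists_normalForm_R (hz : z ∈ zeros S p) :
    ∃ e ∈ contDiffGroupoid ∞ 𝓘(ℝ, ℝ), z.2 ∈ e.source ∧ e z.2 = 0 ∧
      ∀ y ∈ e.source, S.R z.1 y = rightSign S p z.2 * e y ^ p := by
  obtain ⟨G, hG, hRG, hGz⟩ := exists_R_eq_pow_mul hz
  have hsign := sign_neg_mul_div_factorial (S := S) (p := p) z.2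
  rw [← hGz] at hsign
  have hGz0 : G z.2 ≠ 0 := fun h => rightSign_ne_zero hz (by rw [← hsign, h, sign_zero])
  obtain ⟨e, he, hze, hez, -, hRe⟩ :=
    exists_normalForm hG (Nat.one_le_iff_ne_zero.mp hz.2.1) hRG hGz0
  exact ⟨e, he, hze, hez, hsign ▸ hRe⟩

theorem sign_signType_cast (τ : SignType) : SignType.sign (τ : ℝ) = τ := by
  cases τ <;> simp

theorem exists_hasCoeff_sublevelMass_R {τ : SignType} (hτ : τ ≠ 0) {q : ℕ} (hz : z ∈ zeros S q)
    (hp : p ≠ 0) (hpq : p ∣ q → q ≤ 2 * p) :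
    ∃ U ∈ 𝓝 z.2, ∀ h ∈ testFunctions, tsupport h ⊆ U →
      HasCoeff (1 / (p : ℝ)) (sublevelMass (fun y => τ * S.R z.1 y) h)
        ((if q = p then sideCount (τ * rightSign S q z.2) q *
          ((q.factorial ^ (1 / (q : ℝ)) : ℝ) : ℂ) / weight S q z.2 else 0) * h z.2) := by
  obtain ⟨G, hG, hRG, hGz⟩ := exists_R_eq_pow_mul hz
  have hτ1 : |(τ : ℝ)| = 1 := by cases τ <;> simp at hτ ⊢
  have hsign : SignType.sign ((τ : ℝ) * G z.2) = τ * rightSign S q z.2 := by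
    rw [sign_mul, sign_signType_cast, hGz, sign_neg_mul_div_factorial]
  have hne : (τ : ℝ) * G z.2 ≠ 0 := by
    rw [← sign_ne_zero, hsign]
    exact mul_ne_zero hτ (rightSign_ne_zero hz)
  obtain ⟨U, hU, hcoeff⟩ := exists_hasCoeff_sublevelMass (f := fun y => τ * S.R z.1 y)
    (contDiff_const.mul hG) (Nat.one_le_iff_ne_zero.mp hz.2.1)
    (fun y => by rw [hRG, mul_left_comm]) hne
  refine ⟨U, hU, fun h hh hs => ?_⟩
  have hroot : |(τ : ℝ) * G z.2| ^ (1 / (q : ℝ)) =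
      weight S q z.2 / (q.factorial : ℝ) ^ (1 / (q : ℝ)) := by
    rw [abs_mul, hτ1, one_mul, hGz, abs_div, abs_neg, Nat.abs_cast,
      Real.div_rpow (abs_nonneg _) (by positivity), weight]
  have := hcoeff h hh hs p hp hpq
  rw [hsign, hroot, Complex.ofReal_div, div_div_eq_mul_div] at this
  exact this

/-- `Z` consists of those zeros of order `p` next to which `τ R_n` takes positive values, and at
each of them it does so on exactly `m` sides. -/
structure IsSideSelected (S : ScalingData) (p : ℕ) (τ : SignType) (m : ℕ) (Z : Set (ℤ × ℝ)) :
    Prop where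
  sign_ne_zero : τ ≠ 0
  count_ne_zero : m ≠ 0
  subset : Z ⊆ zeros S p
  sideCount_eq : ∀ z ∈ zeros S p, sideCount (τ * rightSign S p z.2) p = Z.indicator (fun _ => m) z

variable {τ : SignType} {m : ℕ} {Z : Set (ℤ × ℝ)}

theorem isSideSelected_zeros (hp : Odd p) : IsSideSelected S p 1 1 (zeros S p) where
  sign_ne_zero := by decide
  count_ne_zero := one_ne_zero
  subset := subset_rfl
  sideCount_eq z hz := by
    have hσ := rightSign_ne_zero hz
    rw [Set.indicator_of_mem hz, one_mul, sideCount, hp.neg_one_pow]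
    generalize rightSign S p z.2 = σ at hσ
    revert σ
    decide

theorem isSideSelected_signedZeros (hp : Even p) {ε : SignType} (hε : ε ≠ 0) :
    IsSideSelected S p (-ε) 2 (signedZeros S p ε) where
  sign_ne_zero := by revert ε; decide
  count_ne_zero := two_ne_zero
  subset := fun _ hz => hz.1
  sideCount_eq z hz := by
    classical
    rw [Set.indicator_apply, sideCount, hp.neg_one_pow, rightSign]
    simp only [signedZeros, Set.mem_ofPred_eq, hz, true_and]
    generalize SignType.sign (iteratedDeriv p S.α z.2) = σ
    revert ε σ
    decide

end Zeros

/-! ### The rigging maps -/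

section RiggingMap

variable {S : ScalingData} {p m : ℕ} {τ : SignType} {Z : Set (ℤ × ℝ)}

section Vanishing

variable (hb : ConditionB' S) (hp : p ≠ 0) (hc : ∀ q ∈ orders S, p ∣ q → q ≤ 2 * p)
  (hZ : IsSideSelected S p τ m Z)

include hb hp hc hZ

theorem exists_hasCoeff_sublevelMass_indicator {z : ℤ × ℝ} (hz : S.R z.1 z.2 = 0) :
    ∃ U ∈ 𝓝 z.2, ∀ h ∈ testFunctions, tsupport h ⊆ U →
      HasCoeff (1 / (p : ℝ)) (sublevelMass (fun y => τ * S.R z.1 y) h)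
        (Z.indicator (fun z =>
          m * ((p.factorial ^ (1 / (p : ℝ)) : ℝ) : ℂ) / weight S p z.2) z * h z.2) := by
  obtain ⟨q, hq⟩ := hb.exists_hasOrder (mem_integerSet_of_R_eq_zero hz)
  obtain ⟨U, hU, hcoeff⟩ := exists_hasCoeff_sublevelMass_R hZ.sign_ne_zero
    (show z ∈ zeros S q from ⟨hz, hq⟩) hp (hc q ⟨z, hz, hq⟩)
  refine ⟨U, hU, fun h hh hs => ?_⟩
  convert hcoeff h hh hs using 2
  split_ifs with hqp
  · subst hqp
    rw [hZ.sideCount_eq z ⟨hz, hq⟩]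
    by_cases hzZ : z ∈ Z <;> simp [hzZ]
  · exact Set.indicator_of_notMem (fun hzZ => hqp (hq.unique (hZ.subset hzZ).2)) _

theorem hasCoeff_sublevelMass_R (n : ℤ) {h : ℝ → ℂ} (hh : h ∈ testFunctions) :
    HasCoeff (1 / (p : ℝ)) (sublevelMass (fun y => τ * S.R n y) h)
      (∑ᶠ x, Z.indicator (fun z =>
        m * ((p.factorial ^ (1 / (p : ℝ)) : ℝ) : ℂ) / weight S p z.2) (n, x) * h x) := by
  have hfin : {x | S.R n x = 0 ∧ x ∈ tsupport h}.Finite :=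
    (hb.finite_inter hh.2.isCompact).subset fun x hx => ⟨mem_integerSet_of_R_eq_zero hx.1, hx.2⟩
  rw [finsum_eq_sum_of_support_subset (s := hfin.toFinset)]
  · refine hasCoeff_sublevelMass_sum (continuous_const.mul (continuous_R S n)) _ (fun x hx => ?_) hh
      fun x hx hR => hfin.mem_toFinset.mpr ⟨?_, hx⟩
    · exact exists_hasCoeff_sublevelMass_indicator hb hp hc hZ (z := (n, x))
        (hfin.mem_toFinset.mp hx).1
    · exact (mul_eq_zero.mp hR).resolve_left
        (sign_ne_zero.mp ((sign_signType_cast τ).trans_ne hZ.sign_ne_zero))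
  · intro x hx
    have hxZ : (n, x) ∈ Z := Set.mem_of_indicator_ne_zero (left_ne_zero_of_mul hx)
    exact hfin.mem_toFinset.mpr
      ⟨(hZ.subset hxZ).1, subset_tsupport _ (right_ne_zero_of_mul hx)⟩

theorem hasCoeff_sum_sublevelMass (H : ℤ →₀ testFunctions) :
    HasCoeff (1 / (p : ℝ))
      (fun s => ∑ n ∈ H.support, sublevelMass (fun y => τ * S.R n y) (H n).1 s)
      (m * ((p.factorial ^ (1 / (p : ℝ)) : ℝ) : ℂ) *
        ∑ᶠ z : Z, (H z.1.1).1 z.1.2 / (weight S p z.1.2 : ℂ)) := by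
  convert HasCoeff.sum H.support fun n _ => hasCoeff_sublevelMass_R hb hp hc hZ n (H n).2 using 1
  set C : ℂ := m * ((p.factorial ^ (1 / (p : ℝ)) : ℝ) : ℂ)
  let F : ℤ × ℝ → ℂ := fun z =>
    Z.indicator (fun z => C / weight S p z.2) z * (H z.1).1 z.2
  have hF : (Function.support F).Finite := (hb.finite_zeros H).subset fun z hz =>
    ⟨(hZ.subset (Set.mem_of_indicator_ne_zero (left_ne_zero_of_mul hz))).1,
      right_ne_zero_of_mul hz⟩
  have hsupp : (Function.support fun n => ∑ᶠ x, F (n, x)) ⊆ H.support := by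
    refine fun n hn => Finsupp.mem_support_iff.mpr fun h0 => hn ?_
    simp [F, h0]
  calc C * ∑ᶠ z : Z, (H z.1.1).1 z.1.2 / (weight S p z.1.2 : ℂ)
      = ∑ᶠ z : Z, F z := by
        rw [mul_finsum]
        refine finsum_congr fun z => ?_
        simp only [F, Set.indicator_of_mem z.2]
        ring
    _ = ∑ᶠ z, F z := by
        rw [finsum_set_coe_eq_finsum_mem, finsum_mem_def]
        refine finsum_congr fun z => ?_
        by_cases hz : z ∈ Z <;> simp [F, hz]
    _ = ∑ n ∈ H.support, ∑ᶠ x, F (n, x) := by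
        rw [finsum_curry F hF, finsum_eq_sum_of_support_subset _ hsupp]

theorem finsum_div_weight_eq_zero {H : ℤ →₀ testFunctions} (hH : ∀ t, gaugeTransform S t H = 0) :
    ∑ᶠ z : Z, (H z.1.1).1 z.1.2 / (weight S p z.1.2 : ℂ) = 0 := by
  have hcoeff := hasCoeff_sum_sublevelMass hb hp hc hZ H
  have hzero : (fun s => ∑ n ∈ H.support, sublevelMass (fun y => τ * S.R n y) (H n).1 s) = 0 :=
    funext fun s => sum_setIntegral_preimage_eq_zero
      (fun n => (continuous_R S n).measurable) (fun n => integrable_of_mem_testFunctions (H n).2) hH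
      (measurableSet_Ioo.preimage (measurable_const_mul (τ : ℝ)))
  rw [hzero] at hcoeff
  refine (mul_eq_zero.mp hcoeff.eq_zero).resolve_left (mul_ne_zero ?_ ?_)
  · exact Nat.cast_ne_zero.mpr hZ.count_ne_zero
  · exact Complex.ofReal_ne_zero.mpr (Real.rpow_pos_of_pos (by positivity) _).ne'

end Vanishing

theorem pointFinite_evalAt (hb : ConditionB' S) (hZ : Z ⊆ zeros S p) :
    PointFinite fun z : Z => evalAt S z := fun f =>
  ((hb.finite_zeros (components S f)).preimage Subtype.val_injective.injOn).subset
    fun z hz => ⟨(hZ z.2).1, hz⟩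

/-- The map `f ↦ (g ↦ ∑ conj (f_n(x)) g_n(x) / |α⁽ᵖ⁾(x) N(x)| ^ (1/p))`, the sum being over a set
`Z` of zeros `(n, x)` of order `p`; for suitable `Z` it is `η_p` or `η_{p,ε}`. -/
def zeroSum (hb : ConditionB' S) (hZ : Z ⊆ zeros S p) : AntilinearToDual S :=
  weightedForm (pointFinite_evalAt hb hZ) fun z => weight S p z.1.2

theorem isZeroSum_zeroSum (hb : ConditionB' S) (hZ : Z ⊆ zeros S p) :
    IsZeroSum p Z (zeroSum hb hZ) := fun f _ =>
  ⟨(pointFinite_evalAt hb hZ).finite_support f fun z (h : comp S f z.1.1 z.1.2 = 0) => by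
    simp [h], rfl⟩

theorem zeroSum_act (hb : ConditionB' S) (hp : p ≠ 0)
    (hc : ∀ q ∈ orders S, p ∣ q → q ≤ 2 * p) (hZ : IsSideSelected S p τ m Z)
    (A : Observable S) (f g : testSpace S) :
    zeroSum hb hZ.subset (A.act f) g = zeroSum hb hZ.subset f (A.adjAct g) := by
  have hfin := pointFinite_evalAt hb hZ.subset
  rw [zeroSum, weightedForm_apply, weightedForm_apply, ← sub_eq_zero,
    ← finsum_sub_distrib (hfin.finite_support g fun i h => by simp [h])
      (hfin.finite_support f fun i h => by simp [h]),
    ← finsum_div_weight_eq_zero hb hp hc hZ (A.gaugeTransform_pairing_sub f g)]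
  refine finsum_congr fun z => ?_
  rw [← sub_div, ← pairing_apply, ← pairing_apply]
  rfl

theorem isRiggingMap_zeroSum (hb : ConditionB' S) (hp : p ≠ 0)
    (hc : ∀ q ∈ orders S, p ∣ q → q ≤ 2 * p) (hZ : IsSideSelected S p τ m Z) :
    IsRiggingMap (zeroSum hb hZ.subset) where
  real f g := (conj_weightedForm _ _ f g).symm
  nonneg f := ⟨_, finsum_nonneg fun z => div_nonneg (sq_nonneg _)
    (hZ.subset z.2).2.weight_pos.le, weightedForm_self _ _ f⟩
  invariant t f := by
    have heval : ∀ z : Z, ∀ g, evalAt S z (gaugeTest S (-t) g) = evalAt S z g := fun z g => by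
      simp [evalAt_apply, comp_gaugeTest, (hZ.subset z.2).1]
    refine LinearMap.ext fun g => ?_
    simp only [LinearMap.dualMap_apply, zeroSum, weightedForm_apply, heval]
  intertwines := zeroSum_act hb hp hc hZ

end RiggingMap

/-! ### Observables from formally adjoint operators on `Φ` -/

section ExtendByZero

variable {𝕜 E : Type*} [RCLike 𝕜] [NormedAddCommGroup E] [InnerProductSpace 𝕜 E]
  {V : Submodule 𝕜 E} {A B : V →ₗ[𝕜] V}

/-- The extension of an operator on the subspace `V` by zero on `Vᗮ`. Its domain `V ⊔ Vᗮ` is dense,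
whether or not `V` is, so that the extension has an adjoint. -/
def extendByZero (A : V →ₗ[𝕜] V) : E →ₗ.[𝕜] E :=
  LinearPMap.sup ⟨V, V.subtype ∘ₗ A⟩ ⟨Vᗮ, 0⟩
    (LinearPMap.sup_h_of_disjoint _ _ V.orthogonal_disjoint)

theorem extendByZero_apply (f : V) (k : Vᗮ) (x : (extendByZero A).domain) (hx : (f : E) + k = x) :
    extendByZero A x = A f :=
  (LinearPMap.sup_apply (LinearPMap.sup_h_of_disjoint _ _ V.orthogonal_disjoint) f k x hx).trans
    (add_zero _)

theorem le_extendByZero_domain : V ≤ (extendByZero A).domain :=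
  (le_sup_left : V ≤ V ⊔ Vᗮ)

theorem extendByZero_coe (f : V) (hf : (f : E) ∈ (extendByZero A).domain) :
    extendByZero A ⟨f, hf⟩ = A f :=
  extendByZero_apply f 0 _ (add_zero _)

theorem inner_extendByZero (hAB : ∀ f g : V, inner 𝕜 (B g : E) (f : E) = inner 𝕜 (g : E) (A f : E))
    (g : V) (x : (extendByZero A).domain) :
    inner 𝕜 (B g : E) (x : E) = inner 𝕜 (g : E) (extendByZero A x) := by
  obtain ⟨f, hf, k, hk, hx⟩ := Submodule.mem_sup.mp x.2
  rw [extendByZero_apply ⟨f, hf⟩ ⟨k, hk⟩ x hx, ← hx, inner_add_right,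
    (Submodule.mem_orthogonal _ _).mp hk _ (B g).2, add_zero, ← hAB ⟨f, hf⟩ g]

theorem dense_extendByZero_domain [CompleteSpace E] :
    Dense ((extendByZero A).domain : Set E) := by
  change Dense ((V ⊔ Vᗮ : Submodule 𝕜 E) : Set E)
  rw [Submodule.dense_iff_topologicalClosure_eq_top, Submodule.topologicalClosure_eq_top_iff,
    ← Submodule.inf_orthogonal]
  exact Submodule.inf_orthogonal_eq_bot _

theorem extendByZero_adjoint_apply [CompleteSpace E]
    (hAB : ∀ f g : V, inner 𝕜 (B g : E) (f : E) = inner 𝕜 (g : E) (A f : E))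
    (g : V) (hg : (g : E) ∈ (extendByZero A)†.domain) : (extendByZero A)† ⟨g, hg⟩ = B g :=
  LinearPMap.adjoint_apply_eq dense_extendByZero_domain _ (inner_extendByZero hAB g)

end ExtendByZero

section Observables

variable {S : ScalingData} {A B : testSpace S →ₗ[ℂ] testSpace S}

/-- The observable given by an operator `A` on `Φ` that commutes with the gauge group and has the
formal adjoint `B` on `Φ`. -/
def Observable.ofFormalAdjoint
    (hAB : ∀ f g : testSpace S, inner ℂ (B g : Haux) (f : Haux) = inner ℂ (g : Haux) (A f : Haux))
    (hA : ∀ t f, A (gaugeTest S t f) = gaugeTest S t (A f)) : Observable S where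
  op := extendByZero A
  dense := dense_extendByZero_domain
  le_domain := le_extendByZero_domain
  le_adjoint_domain g hg :=
    LinearPMap.mem_adjoint_domain_of_exists _ ⟨B ⟨g, hg⟩, inner_extendByZero hAB ⟨g, hg⟩⟩
  maps f := by
    rw [extendByZero_coe]
    exact (A f).2
  adjoint_maps g := by
    rw [extendByZero_adjoint_apply hAB]
    exact (B g).2
  commutes t f := by
    rw [extendByZero_coe, extendByZero_coe, hA]
    rfl

theorem Observable.ofFormalAdjoint_adjAct
    (hAB : ∀ f g : testSpace S, inner ℂ (B g : Haux) (f : Haux) = inner ℂ (g : Haux) (A f : Haux))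
    (hA : ∀ t f, A (gaugeTest S t f) = gaugeTest S t (A f)) :
    (Observable.ofFormalAdjoint hAB hA).adjAct = B :=
  LinearMap.ext fun g => Subtype.ext (extendByZero_adjoint_apply hAB g _)

section Transport

variable {e : OpenPartialHomeomorph ℝ ℝ} {w : ℝ → ℂ}

theorem mul_comp_mem_testFunctions (he : e ∈ contDiffGroupoid ∞ 𝓘(ℝ, ℝ)) (hw : w ∈ testFunctions)
    (hs : tsupport w ⊆ e.source) {ψ : ℝ → ℂ} (hψ : ContDiff ℝ ∞ ψ) :
    (fun x => w x * ψ (e x)) ∈ testFunctions := by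
  refine ⟨contMDiff_iff_contDiff.mp
    (contMDiff_of_tsupport fun x hx => contMDiffAt_iff_contDiffAt.mpr ?_), hw.2.mul_right⟩
  have hx' : x ∈ e.source := hs (tsupport_mul_subset_left hx)
  exact hw.1.contDiffAt.mul
    (hψ.contDiffAt.comp x (contDiffAt_of_mem_contDiffGroupoid he hx'))

theorem tsupport_conj_mul_subset (ψ : ℝ → ℂ) :
    tsupport (fun x => starRingEnd ℂ (w x) * ψ x) ⊆ tsupport w :=
  tsupport_mul_subset_left.trans (tsupport_comp_subset (map_zero _) w)

theorem conj_mul_mem_testFunctions (hw : w ∈ testFunctions) {ψ : ℝ → ℂ} (hψ : ContDiff ℝ ∞ ψ) :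
    (fun x => starRingEnd ℂ (w x) * ψ x) ∈ testFunctions :=
  ⟨(Complex.conjCLE.contDiff.comp hw.1).mul hψ, (hw.2.comp_left (map_zero _)).mul_right⟩

variable (he : e ∈ contDiffGroupoid ∞ 𝓘(ℝ, ℝ)) (hw : w ∈ testFunctions)
  (hs : tsupport w ⊆ e.source)

/-- The operator `ψ ↦ w · (ψ ∘ e)` on test functions, for a cut-off `w` supported in the domain of
the local diffeomorphism `e`. -/
def transport : testFunctions →ₗ[ℂ] testFunctions where
  toFun ψ := ⟨fun x => w x * ψ.1 (e x), mul_comp_mem_testFunctions he hw hs ψ.2.1⟩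
  map_add' ψ χ := Subtype.ext (funext fun x => by simp [mul_add])
  map_smul' c ψ := Subtype.ext (funext fun x => by simp [mul_left_comm])

/-- The formal adjoint of `transport`, which pushes the density `conj w · ψ` forward along `e`. -/
def transportAdjoint : testFunctions →ₗ[ℂ] testFunctions where
  toFun ψ := ⟨pushDensity e fun x => starRingEnd ℂ (w x) * ψ.1 x,
    pushDensity_mem_testFunctions he (conj_mul_mem_testFunctions hw ψ.2.1)
      ((tsupport_conj_mul_subset _).trans hs)⟩
  map_add' ψ χ := Subtype.ext (funext fun u => by
    by_cases hu : u ∈ e.target <;> simp [pushDensity, hu, mul_add])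
  map_smul' c ψ := Subtype.ext (funext fun u => by
    by_cases hu : u ∈ e.target <;> simp [pushDensity, hu, mul_left_comm])

theorem integral_conj_mul_transportAdjoint (φ ψ : testFunctions) :
    ∫ u, starRingEnd ℂ (φ.1 u) * (transportAdjoint he hw hs ψ).1 u
      = ∫ x, starRingEnd ℂ ((transport he hw hs φ).1 x) * ψ.1 x := by
  have hsupp := (subset_tsupport _).trans ((tsupport_conj_mul_subset (w := w) ψ.1).trans hs)
  have h := integral_pushDensity_mul he hsupp fun u => starRingEnd ℂ (φ.1 u)
  simp only [mul_comm _ (starRingEnd ℂ (φ.1 _))] at h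
  refine h.trans (integral_congr_ae (.of_forall fun x => ?_))
  simp only [transport, LinearMap.coe_mk, AddHom.coe_mk, map_mul]
  ring

theorem transportAdjoint_phaseMul {n m : ℤ} (hR : ∀ x ∈ e.source, S.R m (e x) = S.R n x) (t : ℝ)
    (ψ : testFunctions) : transportAdjoint he hw hs (phaseMul S t n ψ)
      = phaseMul S t m (transportAdjoint he hw hs ψ) := by
  refine Subtype.ext (funext fun u => ?_)
  simp only [transportAdjoint, phaseMul, LinearMap.coe_mk, AddHom.coe_mk]
  rw [mul_comm, ← pushDensity_mul_comp (k := fun u => Complex.exp (Complex.I * (S.R m u * t : ℝ)))]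
  congr 1
  funext x
  by_cases hx : x ∈ e.source
  · rw [hR x hx, mul_right_comm, mul_assoc]
  · rw [image_eq_zero_of_notMem_tsupport fun h => hx (hs h)]
    simp only [map_zero, zero_mul]

end Transport

/-- The operator on `Φ` that applies `T` to the component `n` and puts the result into the
component `m`. -/
def moveMode (S : ScalingData) (n m : ℤ) (T : testFunctions →ₗ[ℂ] testFunctions) :
    testSpace S →ₗ[ℂ] testSpace S :=
  (components S).symm.toLinearMap ∘ₗ Finsupp.lsingle m ∘ₗ T ∘ₗ Finsupp.lapply n ∘ₗ
    (components S).toLinearMap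

theorem comp_moveMode (n m : ℤ) (T : testFunctions →ₗ[ℂ] testFunctions) (f : testSpace S) (k : ℤ)
    (x : ℝ) : comp S (moveMode S n m T f) k x = if m = k then (T (components S f n)).1 x else 0 :=
  comp_components_symm_single m (T (components S f n)) k x

theorem coe_moveMode (n m : ℤ) (T : testFunctions →ₗ[ℂ] testFunctions) (f : testSpace S) :
    (moveMode S n m T f : Haux) = mode S m (T (components S f n)) :=
  coe_components_symm_single m (T (components S f n))

theorem components_gaugeTest (t : ℝ) (f : testSpace S) (n : ℤ) :
    components S (gaugeTest S t f) n = phaseMul S t n (components S f n) :=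
  Subtype.ext (funext fun x => comp_gaugeTest t f n x)

theorem gaugeTest_moveMode {n m : ℤ} {T : testFunctions →ₗ[ℂ] testFunctions} {t : ℝ}
    (hT : ∀ ψ, T (phaseMul S t n ψ) = phaseMul S t m (T ψ)) (f : testSpace S) :
    moveMode S n m T (gaugeTest S t f) = gaugeTest S t (moveMode S n m T f) := by
  refine Subtype.ext ?_
  change _ = gauge S t (moveMode S n m T f : Haux)
  rw [coe_moveMode, coe_moveMode, gauge_mode, components_gaugeTest, hT]

theorem inner_moveMode {n m : ℤ} {T T' : testFunctions →ₗ[ℂ] testFunctions}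
    (hT : ∀ φ ψ : testFunctions, ∫ u, starRingEnd ℂ (φ.1 u) * (T' ψ).1 u
      = ∫ x, starRingEnd ℂ ((T φ).1 x) * ψ.1 x) (f g : testSpace S) :
    inner ℂ (moveMode S m n T g : Haux) (f : Haux)
      = inner ℂ (g : Haux) (moveMode S n m T' f : Haux) := by
  rw [← inner_conj_symm (g : Haux), coe_moveMode, coe_moveMode, inner_mode_testSpace,
    inner_mode_testSpace, ← integral_conj]
  simp only [map_mul, Complex.conj_conj, mul_comm _ (starRingEnd ℂ (comp S g _ _))]
  exact (hT (components S g m) (components S f n)).symm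

theorem exists_observable_adjAct_eq_mul_comp {e : OpenPartialHomeomorph ℝ ℝ}
    (he : e ∈ contDiffGroupoid ∞ 𝓘(ℝ, ℝ)) {w : ℝ → ℂ} (hw : w ∈ testFunctions)
    (hs : tsupport w ⊆ e.source) {n m : ℤ} (hR : ∀ x ∈ e.source, S.R m (e x) = S.R n x) :
    ∃ A : Observable S, ∀ (g : testSpace S) (k : ℤ) (x : ℝ),
      comp S (A.adjAct g) k x = if n = k then w x * comp S g m (e x) else 0 := by
  refine ⟨Observable.ofFormalAdjoint (inner_moveMode (integral_conj_mul_transportAdjoint he hw hs))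
    fun t => gaugeTest_moveMode (transportAdjoint_phaseMul he hw hs hR t), fun g k x => ?_⟩
  rw [Observable.ofFormalAdjoint_adjAct, comp_moveMode]
  rfl

section Intertwining

variable {p : ℕ} {z z' : ℤ × ℝ}

theorem exists_normalForm_R_of_odd_or_eq (hz : z ∈ zeros S p) {σ : SignType} (hσ : σ ≠ 0)
    (h : Odd p ∨ σ = rightSign S p z.2) :
    ∃ e ∈ contDiffGroupoid ∞ 𝓘(ℝ, ℝ), z.2 ∈ e.source ∧ e z.2 = 0 ∧
      ∀ y ∈ e.source, S.R z.1 y = σ * e y ^ p := by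
  obtain ⟨e, he, hze, hez, hR⟩ := exists_normalForm_R hz
  by_cases heq : σ = rightSign S p z.2
  · exact ⟨e, he, hze, hez, heq ▸ hR⟩
  · have hodd := h.resolve_right heq
    have hneg : rightSign S p z.2 = -σ := by
      have hσ' := rightSign_ne_zero hz
      generalize rightSign S p z.2 = σ' at hσ' heq
      clear h
      decide +revert
    refine ⟨e.trans (Homeomorph.neg ℝ).toOpenPartialHomeomorph,
      StructureGroupoid.trans _ he neg_mem_contDiffGroupoid, ⟨hze, Set.mem_univ _⟩,
      neg_eq_zero.mpr hez, fun y hy => ?_⟩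
    have hcast : ((-σ : SignType) : ℝ) = -(σ : ℝ) := by cases σ <;> simp
    change _ = (σ : ℝ) * (-e y) ^ p
    rw [hR y hy.1, hneg, hcast, hodd.neg_pow, mul_neg, neg_mul]

theorem exists_intertwining_diffeo (hz : z ∈ zeros S p) (hz' : z' ∈ zeros S p)
    (h : Odd p ∨ rightSign S p z.2 = rightSign S p z'.2) :
    ∃ e ∈ contDiffGroupoid ∞ 𝓘(ℝ, ℝ), z.2 ∈ e.source ∧ e z.2 = z'.2 ∧
      ∀ y ∈ e.source, S.R z'.1 (e y) = S.R z.1 y := by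
  obtain ⟨e, he, hze, hez, hR⟩ := exists_normalForm_R hz
  obtain ⟨e', he', hze', hez', hR'⟩ :=
    exists_normalForm_R_of_odd_or_eq hz' (rightSign_ne_zero hz) h
  have h0 : (0 : ℝ) ∈ e'.target := hez' ▸ e'.map_source hze'
  refine ⟨e.trans e'.symm, StructureGroupoid.trans _ he (StructureGroupoid.symm _ he'),
    ⟨hze, by simpa [hez] using h0⟩, ?_, fun y hy => ?_⟩
  · rw [OpenPartialHomeomorph.trans_apply, hez, ← hez', e'.left_inv hze']
  · have hy' : e y ∈ e'.target := hy.2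
    rw [OpenPartialHomeomorph.trans_apply, hR' _ (e'.map_target hy'), e'.right_inv hy', hR y hy.1]

end Intertwining

end Observables

/-! ### Irreducibility -/

section Irreducibility

variable {S : ScalingData} {p : ℕ} {Z : Set (ℤ × ℝ)}

theorem ConditionB'.exists_testFunction_separating (hb : ConditionB' S) {x : ℝ} {U : Set ℝ}
    (hU : U ∈ 𝓝 x) :
    ∃ w ∈ testFunctions, tsupport w ⊆ U ∧ w x = 1 ∧ ∀ y ∈ integerSet S, y ≠ x → w y = 0 := by
  have hV := hb.2.2.1 x
  rw [accPt_iff_frequently_nhdsNE, Filter.not_frequently, eventually_nhdsWithin_iff] at hV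
  obtain ⟨w, hw, hs, h1⟩ := exists_testFunction_eventuallyEq_one (Filter.inter_mem hU hV)
  refine ⟨w, hw, hs.trans Set.inter_subset_left, h1.self_of_nhds, fun y hy hyx => ?_⟩
  exact image_eq_zero_of_notMem_tsupport fun hys => (hs hys).2 hyx hy

theorem exists_evalAt_eq_one (hb : ConditionB' S) (z : ℤ × ℝ) :
    ∃ g : testSpace S, evalAt S z g = 1 ∧
      ∀ y : ℤ × ℝ, S.R y.1 y.2 = 0 → y ≠ z → evalAt S y g = 0 := by
  obtain ⟨w, hw, -, h1, h0⟩ := hb.exists_testFunction_separating (x := z.2) Filter.univ_mem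
  refine ⟨(components S).symm (Finsupp.single z.1 ⟨w, hw⟩), ?_, fun y hy hyz => ?_⟩
  · rw [evalAt_apply, comp_components_symm_single, if_pos rfl]
    exact h1
  · rw [evalAt_apply, comp_components_symm_single]
    split_ifs with hn
    · exact h0 _ (mem_integerSet_of_R_eq_zero hy) fun hx => hyz (Prod.ext hn.symm hx)
    · rfl

theorem exists_observable_matrixUnit (hb : ConditionB' S) {z z' : ℤ × ℝ} (hz : z ∈ zeros S p)
    (hz' : z' ∈ zeros S p) (h : Odd p ∨ rightSign S p z.2 = rightSign S p z'.2) :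
    ∃ A : Observable S, (∀ g, evalAt S z (A.adjAct g) = evalAt S z' g) ∧
      ∀ y : ℤ × ℝ, S.R y.1 y.2 = 0 → y ≠ z → ∀ g, evalAt S y (A.adjAct g) = 0 := by
  obtain ⟨e, he, hze, hez, hR⟩ := exists_intertwining_diffeo hz hz' h
  obtain ⟨w, hw, hs, h1, h0⟩ :=
    hb.exists_testFunction_separating (e.open_source.mem_nhds hze)
  obtain ⟨A, hA⟩ := exists_observable_adjAct_eq_mul_comp he hw hs hR
  refine ⟨A, fun g => ?_, fun y hy hyz g => ?_⟩
  · rw [evalAt_apply, hA, if_pos rfl, h1, hez, one_mul, evalAt_apply]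
  · rw [evalAt_apply, hA]
    split_ifs with hn
    · rw [h0 _ (mem_integerSet_of_R_eq_zero hy) fun hx => hyz (Prod.ext hn.symm hx), zero_mul]
    · rfl

theorem exists_zeroSum_ne_zero (hb : ConditionB' S) (hZ : Z ⊆ zeros S p) (hne : Z.Nonempty) :
    ∃ f, zeroSum hb hZ f ≠ 0 := by
  obtain ⟨z, hz⟩ := hne
  obtain ⟨f, h1, h0⟩ := exists_evalAt_eq_one hb z
  refine ⟨f, fun h => ?_⟩
  have hf : zeroSum hb hZ f f = 0 := by rw [h, LinearMap.zero_apply]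
  have hother : ∀ y : Z, y ≠ ⟨z, hz⟩ → evalAt S y f = 0 := fun y hy =>
    h0 y (hZ y.2).1 fun hyz => hy (Subtype.ext hyz)
  rw [zeroSum, weightedForm_eq_single _ _ f hother] at hf
  simp [h1, (hZ hz).2.weight_pos.ne'] at hf

theorem eq_range_zeroSum_of_stable (hb : ConditionB' S) (hZ : Z ⊆ zeros S p)
    (hsign : ∀ z ∈ Z, ∀ z' ∈ Z, Odd p ∨ rightSign S p z.2 = rightSign S p z'.2)
    {W : Submodule ℂ (Module.Dual ℂ (testSpace S))} (hle : W ≤ LinearMap.range (zeroSum hb hZ))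
    (hstable : ∀ A : Observable S, ∀ F ∈ W, A.dualAct F ∈ W) (hW : W ≠ ⊥) :
    W = LinearMap.range (zeroSum hb hZ) := by
  obtain ⟨F, hFW, hF⟩ := W.exists_mem_ne_zero_of_ne_bot hW
  obtain ⟨f, rfl⟩ := hle hFW
  obtain ⟨z, hzf⟩ : ∃ z : Z, evalAt S z f ≠ 0 := by
    by_contra! h
    refine hF (LinearMap.ext fun g => ?_)
    simp [zeroSum, weightedForm_apply, h]
  refine hle.antisymm (range_weightedForm_le _ _ fun z' => ?_)
  obtain ⟨A, hA, hA0⟩ :=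
    exists_observable_matrixUnit hb (hZ z.2) (hZ z'.2) (hsign z z.2 z' z'.2)
  have hother : ∀ y : Z, y ≠ z → ∀ g, evalAt S y (A.adjAct g) = 0 := fun y hy =>
    hA0 y (hZ y.2).1 (Subtype.coe_ne_coe.mpr hy)
  exact mem_of_dualMap_weightedForm_mem (pointFinite_evalAt hb hZ) _
    (hZ z.2).2.weight_pos.ne' hzf hA hother (hstable A _ hFW)

theorem actsIrreducibly_zeroSum (hb : ConditionB' S) (hZ : Z ⊆ zeros S p) (hne : Z.Nonempty)
    (hη : IsRiggingMap (zeroSum hb hZ))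
    (hsign : ∀ z ∈ Z, ∀ z' ∈ Z, Odd p ∨ rightSign S p z.2 = rightSign S p z'.2) :
    ActsIrreducibly (zeroSum hb hZ) where
  nonzero := by
    obtain ⟨f, hf⟩ := exists_zeroSum_ne_zero hb hZ hne
    exact Submodule.ne_bot_iff _ |>.mpr ⟨_, LinearMap.mem_range_self _ f, hf⟩
  stable := by
    rintro A _ ⟨f, rfl⟩
    exact ⟨A.act f, LinearMap.ext fun g => hη.intertwines A f g⟩
  irreducible W hle hstable :=
    or_iff_not_imp_left.mpr fun hW => eq_range_zeroSum_of_stable hb hZ hsign hle hstable hW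

theorem exists_irreducible_riggingMap (hb : ConditionB' S) (hc : ConditionC S)
    {τ : SignType} {m : ℕ} (hZ : IsSideSelected S p τ m Z) (hne : Z.Nonempty)
    (hsign : ∀ z ∈ Z, ∀ z' ∈ Z, Odd p ∨ rightSign S p z.2 = rightSign S p z'.2) :
    ∃ η : AntilinearToDual S, IsZeroSum p Z η ∧ IsRiggingMap η ∧ (∃ f, η f ≠ 0) ∧
      ActsIrreducibly η := by
  obtain ⟨z, hz⟩ := hne.mono hZ.subset
  have hle : ∀ q ∈ orders S, p ∣ q → q ≤ 2 * p := fun q hq hpq => by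
    have := not_lt.mp (hc q hq p ⟨z, hz⟩ hpq)
    exact_mod_cast (by linarith : (q : ℝ) ≤ 2 * p)
  have hη := isRiggingMap_zeroSum hb (Nat.one_le_iff_ne_zero.mp hz.2.1) hle hZ
  exact ⟨zeroSum hb hZ.subset, isZeroSum_zeroSum hb hZ.subset, hη,
    exists_zeroSum_ne_zero hb hZ.subset hne,
    actsIrreducibly_zeroSum hb hZ.subset hne hη hsign⟩

end Irreducibility

end RAQ

end

theorem theorem2_general (S : RAQ.ScalingData) (hb : RAQ.ConditionB' S) (hc : RAQ.ConditionC S) :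
    (∀ p ∈ RAQ.orders S, Odd p →
      ∃ η : RAQ.AntilinearToDual S, RAQ.IsZeroSum p (RAQ.zeros S p) η ∧
        RAQ.IsRiggingMap η ∧ (∃ f, η f ≠ 0) ∧ RAQ.ActsIrreducibly η) ∧
    (∀ p ∈ RAQ.orders S, Even p → ∀ ε : SignType, ε ≠ 0 → (RAQ.signedZeros S p ε).Nonempty →
      ∃ η : RAQ.AntilinearToDual S, RAQ.IsZeroSum p (RAQ.signedZeros S p ε) η ∧
        RAQ.IsRiggingMap η ∧ (∃ f, η f ≠ 0) ∧ RAQ.ActsIrreducibly η) := by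
  refine ⟨fun p hp hodd => ?_, fun p _ heven ε hε hne => ?_⟩
  · exact RAQ.exists_irreducible_riggingMap hb hc (RAQ.isSideSelected_zeros hodd) hp
      fun _ _ _ _ => .inl hodd
  · refine RAQ.exists_irreducible_riggingMap hb hc (RAQ.isSideSelected_signedZeros heven hε) hne
      fun z hz z' hz' => .inr ?_
    rw [RAQ.rightSign, RAQ.rightSign, hz.2, hz'.2]

theorem theorem2 (S : RAQ.ScalingData) (ha : RAQ.ConditionA S) (hb : RAQ.ConditionB' S)
    (hc : RAQ.ConditionC S) :
    (∀ p ∈ RAQ.orders S, Odd p →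
      ∃ η : RAQ.AntilinearToDual S, RAQ.IsZeroSum p (RAQ.zeros S p) η ∧
        RAQ.IsRiggingMap η ∧ (∃ f, η f ≠ 0) ∧ RAQ.ActsIrreducibly η) ∧
    (∀ p ∈ RAQ.orders S, Even p → ∀ ε : SignType, ε ≠ 0 → (RAQ.signedZeros S p ε).Nonempty →
      ∃ η : RAQ.AntilinearToDual S, RAQ.IsZeroSum p (RAQ.signedZeros S p ε) η ∧
        RAQ.IsRiggingMap η ∧ (∃ f, η f ≠ 0) ∧ RAQ.ActsIrreducibly η) :=
  theorem2_general S hb hc
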